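/- Conventions. A tracial von Neumann algebra $(M,\tau)$ is a von Neumann algebra $M$ with a faithful normal tracial state $\tau$. A subset $X\subset M$ is called L-free if for every $k\ge 1$ and all $y_1,\dots,y_{2k}\in X$ with $y_i\ne y_{i+1}$ for $1\le i\le 2k-1$, $$\tau(y_1y_2^*\cdots y_{2k-1}y_{2k}^*)=0\quad\text{and}\quad \tau(y_1^*y_2\cdots y_{2k-1}^*y_{2k})=0.$$ Proposition 3.4. Let $(M,\tau)$ be a tracial von Neumann algebra and let $x_1,\dots,x_n\in M$ be such that the set $\{x_1,\dots,x_n\}$ is L-free and $\|x_i\|\le 1$ for all $i$. Let $\mathcal M=M*L(\mathbb F_{n(n-1)})$ be the free product of tracial von Neumann algebras, where $L(\mathbb F_{n(n-1)})$ is the group von Neumann algebra of the free group on $n(n-1)$ generators with its canonical trace. This is a tracial von Neumann algebra, which contains $M$ through a trace preserving unital embedding. Put $\widetilde{\mathcal M}=M_{n+1}(\mathbb C)\otimes\mathcal M$, with the normalized trace $\mathrm{tr}\otimes\tau$, and let $(e_{ij})_{i,j=0,\dots,n}$ be the matrix units of $M_{n+1}(\mathbb C)$. Then there are unitaries $U_1,\dots,U_n\in\widetilde{\mathcal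 M}$ such that the set $\{U_1,\dots,U_n\}$ is L-free in $\widetilde{\mathcal M}$ and $$(e_{00}\otimes 1)\,U_i\,(e_{00}\otimes 1)=e_{00}\otimes x_i\qquad\text{for all } i=1,\dots,n.$$ -/

import Mathlib

open scoped ComplexOrder InnerProductSpace

universe u

/-! ### Tracial von Neumann algebras -/

section Tracial

variable {H : Type u} [NormedAddCommGroup H] [InnerProductSpace ℂ H] [CompleteSpace H]

/-- A linear functional on a von Neumann algebra `M ⊆ B(H)` is normal (σ-weakly continuous) if it
is of the form `x ↦ ∑ₖ ⟪ξₖ, x ηₖ⟫` for sequences `ξ`, `η` in `H` with `∑ₖ ‖ξₖ‖² < ∞` and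
`∑ₖ ‖ηₖ‖² < ∞`. -/
def IsNormalFunctional (M : VonNeumannAlgebra H) (τ : M.toStarSubalgebra →ₗ[ℂ] ℂ) : Prop :=
  ∃ ξ η : ℕ → H, Summable (fun k => ‖ξ k‖ ^ 2) ∧ Summable (fun k => ‖η k‖ ^ 2) ∧
    ∀ x : M.toStarSubalgebra, HasSum (fun k => ⟪ξ k, (x : H →L[ℂ] H) (η k)⟫_ℂ) (τ x)

/-- `τ` is a faithful normal tracial state on the von Neumann algebra `M`; a pair `(M, τ)` with
this property is a tracial von Neumann algebra. -/
structure IsFaithfulNormalTracialState (M : VonNeumannAlgebra H)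
    (τ : M.toStarSubalgebra →ₗ[ℂ] ℂ) : Prop where
  map_one : τ 1 = 1
  nonneg : ∀ x, 0 ≤ τ (star x * x)
  faithful : ∀ x, τ (star x * x) = 0 → x = 0
  tracial : ∀ x y, τ (x * y) = τ (y * x)
  normal : IsNormalFunctional M τ

/-- The von Neumann algebra generated by a set `S` of bounded operators: the double commutant of
`S ∪ S*`. -/
noncomputable def vonNeumannGenerated (S : Set (H →L[ℂ] H)) : VonNeumannAlgebra H where
  toStarSubalgebra := StarSubalgebra.centralizer ℂ (StarSubalgebra.centralizer ℂ S : Set (H →L[ℂ] H))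
  centralizer_centralizer' := by
    change Set.centralizer (Set.centralizer
      (StarSubalgebra.centralizer ℂ (StarSubalgebra.centralizer ℂ S : Set (H →L[ℂ] H)) :
        Set (H →L[ℂ] H))) =
      (StarSubalgebra.centralizer ℂ (StarSubalgebra.centralizer ℂ S : Set (H →L[ℂ] H)) :
        Set (H →L[ℂ] H))
    rw [StarSubalgebra.coe_centralizer_centralizer, Set.centralizer_centralizer_centralizer]

end Tracial

/-! ### Group von Neumann algebras -/

section GroupVonNeumann

universe v

/-- The left regular representation of a group `Γ` on `ℓ²(Γ)`: `(λ(g) f)(h) = f(g⁻¹ h)`. -/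
noncomputable def leftRegular {Γ : Type v} [Group Γ] (g : Γ) :
    lp (fun _ : Γ => ℂ) 2 →L[ℂ] lp (fun _ : Γ => ℂ) 2 :=
  LinearIsometry.toContinuousLinearMap
    { toFun := fun f => ⟨fun h => f (g⁻¹ * h), memℓp_gen
        ((Equiv.mulLeft g⁻¹).summable_iff.mpr ((lp.memℓp f).summable (by norm_num)))⟩
      map_add' := fun f₁ f₂ => rfl
      map_smul' := fun c f => rfl
      norm_map' := fun f => by
        rw [lp.norm_eq_tsum_rpow (by norm_num), lp.norm_eq_tsum_rpow (by norm_num)]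
        exact congrArg (· ^ (1 / (2 : ENNReal).toReal))
          ((Equiv.mulLeft g⁻¹).tsum_eq (fun h => ‖f h‖ ^ (2 : ENNReal).toReal)) }

/-- The group von Neumann algebra `L(Γ)`, generated by the left regular representation. -/
noncomputable def groupVonNeumann (Γ : Type v) [Group Γ] :
    VonNeumannAlgebra (lp (fun _ : Γ => ℂ) 2) :=
  vonNeumannGenerated (Set.range (leftRegular (Γ := Γ)))

open Classical in
/-- The canonical trace `τ(x) = ⟪δ_e, x δ_e⟫` on `L(Γ)`. -/
noncomputable def groupTrace (Γ : Type v) [Group Γ] :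
    (groupVonNeumann Γ).toStarSubalgebra →ₗ[ℂ] ℂ where
  toFun x := ⟪lp.single 2 (1 : Γ) (1 : ℂ),
    (x : lp (fun _ : Γ => ℂ) 2 →L[ℂ] lp (fun _ : Γ => ℂ) 2) (lp.single 2 (1 : Γ) (1 : ℂ))⟫_ℂ
  map_add' x y := by simp
  map_smul' c x := by simp

end GroupVonNeumann

/-! ### Free products of tracial von Neumann algebras -/

section FreeProduct

universe u₁ u₂ u₃

/-- Free independence of a family of unital `*`-subalgebras with respect to `τ`: every nonempty
alternating product of elements of trace zero has trace zero. -/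
def AreFree {A ι : Type*} [Ring A] [StarRing A] [Algebra ℂ A] [StarModule ℂ A]
    (τ : A →ₗ[ℂ] ℂ) (B : ι → StarSubalgebra ℂ A) : Prop :=
  ∀ (m : ℕ) (i : Fin (m + 1) → ι) (a : Fin (m + 1) → A),
    (∀ k, a k ∈ B (i k)) → (∀ k, τ (a k) = 0) →
    (∀ k : Fin m, i k.castSucc ≠ i k.succ) → τ (List.ofFn a).prod = 0

variable {H₁ : Type u₁} [NormedAddCommGroup H₁] [InnerProductSpace ℂ H₁] [CompleteSpace H₁]
  {H₂ : Type u₂} [NormedAddCommGroup H₂] [InnerProductSpace ℂ H₂] [CompleteSpace H₂]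
  {K : Type u₃} [NormedAddCommGroup K] [InnerProductSpace ℂ K] [CompleteSpace K]

/-- `(N, τ)` together with the unital `*`-homomorphisms `φ₁ : M₁ → N` and `φ₂ : M₂ → N` is the
(tracial) free product `(M₁, τ₁) * (M₂, τ₂)` of the tracial von Neumann algebras `(M₁, τ₁)` and
`(M₂, τ₂)`: the maps `φ₁`, `φ₂` preserve the traces (hence, the traces being faithful and normal,
they are injective and normal), and their images are free and generate `N`. -/
structure IsTracialFreeProduct
    (M₁ : VonNeumannAlgebra H₁) (τ₁ : M₁.toStarSubalgebra →ₗ[ℂ] ℂ)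
    (M₂ : VonNeumannAlgebra H₂) (τ₂ : M₂.toStarSubalgebra →ₗ[ℂ] ℂ)
    (N : VonNeumannAlgebra K) (τ : N.toStarSubalgebra →ₗ[ℂ] ℂ)
    (φ₁ : M₁.toStarSubalgebra →⋆ₐ[ℂ] N.toStarSubalgebra)
    (φ₂ : M₂.toStarSubalgebra →⋆ₐ[ℂ] N.toStarSubalgebra) : Prop where
  isTracial : IsFaithfulNormalTracialState N τ
  trace_left : ∀ x, τ (φ₁ x) = τ₁ x
  trace_right : ∀ y, τ (φ₂ y) = τ₂ y
  free : AreFree τ ![φ₁.range, φ₂.range]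
  generates : vonNeumannGenerated
    (Set.range (fun x => (φ₁ x : K →L[ℂ] K)) ∪ Set.range (fun y => (φ₂ y : K →L[ℂ] K))) = N

end FreeProduct

/-! ### L-free sets -/

section LFree

/-- A subset `X` of a `*`-algebra with trace `τ` is L-free if, for all `k ≥ 1`,
`τ (y₁ y₂* ⋯ y₂ₖ₋₁ y₂ₖ*) = 0` and `τ (y₁* y₂ ⋯ y₂ₖ₋₁* y₂ₖ) = 0` whenever `y₁, …, y₂ₖ ∈ X` and
consecutive ones are distinct. (In the code, the indices start at `0`.) -/
def IsLFree {A : Type*} [Monoid A] [Star A] (τ : A → ℂ) (X : Set A) : Prop :=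
  ∀ k : ℕ, 1 ≤ k → ∀ y : Fin (2 * k) → A, (∀ i, y i ∈ X) →
    (∀ i (h : i + 1 < 2 * k), y ⟨i, by lia⟩ ≠ y ⟨i + 1, h⟩) →
    τ (List.ofFn fun j : Fin k =>
        y ⟨2 * j, by lia⟩ * star (y ⟨2 * j + 1, by lia⟩)).prod = 0 ∧
    τ (List.ofFn fun j : Fin k =>
        star (y ⟨2 * j, by lia⟩) * y ⟨2 * j + 1, by lia⟩).prod = 0

/-- The normalized trace `tr ⊗ τ` on `M_d(ℂ) ⊗ A = M_d(A)`. -/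
noncomputable def matrixTrace {A : Type*} {d : ℕ} (τ : A → ℂ) (V : Matrix (Fin d) (Fin d) A) : ℂ :=
  (d : ℂ)⁻¹ * ∑ i, τ (V i i)

end LFree

/-! Let s_i = (1 - x_i* x_i)^{1/2} and t_i = (1 - x_i x_i*)^{1/2}, and let u_{ij}, i ≠ j, be the
n(n-1) free unitaries. In rows and columns 0 and i, U_i is the Halmos dilation with rows (x_i, t_i)
and (s_i, -x_i*); every other diagonal place j carries u_{ij}. The relation x_i s_i = t_i x_i makes
U_i unitary (`exists_defect`, `dilation_mul_dilation`).

A diagonal entry of an alternating product of the U_i and their adjoints is a sum over paths. At 0 a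
path collects factors x_i or x_i*, until it leaves to some j through a defect operator. At j it
collects unitaries u_{ij} or their inverses, until the index j comes up; then it takes ∓-signed x_j
or x_j* and stays, or returns to 0. Adjacent unitaries cannot cancel, since consecutive indices
differ. Two unitaries separated by one factor at j have the same sign, so they do not cancel either.
An excursion through 0 after which cancellation is possible has the form s_j w s_j or t_j w t_j, and
τ(s_j w s_j) = τ(w) - τ(x_j w x_j*) = 0 by L-freeness (`trace_defect_mul_exitWord`). Hence the paths
meeting some u_{ij} add up to combinations of reduced products (`altProd_dilation_entries`), of
trace zero by freeness (`trace_mul_reducedSpan`). The remaining paths give alternating products of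
the x_i, or such excursions, again of trace zero (`trace_altProd_dilation`).

The free product itself is constructed on ℓ² of reduced words in orthonormal bases of the two GNS
spaces. The vacuum state is free (`vacuumState_eq_zero_of_altCentred`), it is tracial on the
generated `*`-algebra (`tracial_of_free`), and a cyclic tracial vector gives a faithful normal trace
on the double commutant (`isFaithfulNormalTracialState_vectorFunctional`). -/

/-! ### Tracial vector states -/

section VectorState

variable {K : Type*} [NormedAddCommGroup K] [InnerProductSpace ℂ K] [CompleteSpace K]

/-- The functional `x ↦ ⟪Ω, x Ω⟫` on a von Neumann algebra. -/
noncomputable def vectorFunctional (N : VonNeumannAlgebra K) (Ω : K) :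
    N.toStarSubalgebra →ₗ[ℂ] ℂ where
  toFun x := ⟪Ω, (x : K →L[ℂ] K) Ω⟫_ℂ
  map_add' x y := by simp
  map_smul' c x := by simp

lemma inner_star_apply (x : K →L[ℂ] K) (ξ η : K) : ⟪star x ξ, η⟫_ℂ = ⟪ξ, x η⟫_ℂ :=
  ContinuousLinearMap.adjoint_inner_left x η ξ

lemma inner_apply_star (x : K →L[ℂ] K) (ξ η : K) : ⟪ξ, star x η⟫_ℂ = ⟪x ξ, η⟫_ℂ :=
  ContinuousLinearMap.adjoint_inner_right x ξ η

/-- The evaluation of a `*`-algebra of operators at a vector. -/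
def evalAt (A : StarSubalgebra ℂ (K →L[ℂ] K)) (Ω : K) : A →ₗ[ℂ] K where
  toFun a := (a : K →L[ℂ] K) Ω
  map_add' _ _ := rfl
  map_smul' _ _ := rfl

lemma ext_of_dense {A : StarSubalgebra ℂ (K →L[ℂ] K)} {Ω : K} (hd : DenseRange (evalAt A Ω))
    {ξ η : K} (h : ∀ a ∈ A, ⟪ξ, a Ω⟫_ℂ = ⟪η, a Ω⟫_ℂ) : ξ = η := by
  refine hd.eq_of_inner_left ℂ ?_
  exact fun a => h a a.2

lemma ext_operator_of_dense {A : StarSubalgebra ℂ (K →L[ℂ] K)} {Ω : K}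
    (hd : DenseRange (evalAt A Ω)) {x y : K →L[ℂ] K} (h : ∀ a ∈ A, x (a Ω) = y (a Ω)) : x = y := by
  refine ContinuousLinearMap.coeFn_injective (hd.equalizer x.continuous y.continuous ?_)
  ext a
  exact h a a.2

lemma norm_star_apply_of_tracial {A : StarSubalgebra ℂ (K →L[ℂ] K)} {Ω : K}
    (htr : ∀ a ∈ A, ∀ b ∈ A, ⟪Ω, (a * b) Ω⟫_ℂ = ⟪Ω, (b * a) Ω⟫_ℂ) {a : K →L[ℂ] K} (ha : a ∈ A) :
    ‖star a Ω‖ = ‖a Ω‖ := by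
  have h := htr (star a) (star_mem ha) a ha
  change ⟪Ω, star a (a Ω)⟫_ℂ = ⟪Ω, a (star a Ω)⟫_ℂ at h
  rw [inner_apply_star, ← inner_star_apply a Ω, inner_self_eq_norm_sq_to_K,
    inner_self_eq_norm_sq_to_K] at h
  have h' : ‖a Ω‖ ^ 2 = ‖star a Ω‖ ^ 2 := by exact_mod_cast h
  exact ((sq_eq_sq₀ (norm_nonneg _) (norm_nonneg _)).1 h').symm

/-- If the vector state of a cyclic vector is tracial, right multiplications are bounded. -/
lemma exists_rightMul {A : StarSubalgebra ℂ (K →L[ℂ] K)} {Ω : K} (hd : DenseRange (evalAt A Ω))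
    (htr : ∀ a ∈ A, ∀ b ∈ A, ⟪Ω, (a * b) Ω⟫_ℂ = ⟪Ω, (b * a) Ω⟫_ℂ) {b : K →L[ℂ] K} (hb : b ∈ A) :
    ∃ r : K →L[ℂ] K, ∀ a ∈ A, r (a Ω) = (a * b) Ω := by
  let f : A →ₗ[ℂ] K := (evalAt A Ω).comp (LinearMap.mulRight ℂ (⟨b, hb⟩ : A))
  have hf : ∃ C, ∀ a : A, ‖f a‖ ≤ C * ‖evalAt A Ω a‖ := by
    -- ‖abΩ‖ = ‖b*a*Ω‖ ≤ ‖b*‖ ‖a*Ω‖ = ‖b*‖ ‖aΩ‖, by traciality at both ends.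
    refine ⟨‖star b‖, fun a => ?_⟩
    change ‖((a : K →L[ℂ] K) * b) Ω‖ ≤ ‖star b‖ * ‖(a : K →L[ℂ] K) Ω‖
    rw [← norm_star_apply_of_tracial htr (mul_mem a.2 hb), ← norm_star_apply_of_tracial htr a.2,
      star_mul]
    exact (star b).le_opNorm _
  exact ⟨f.extendOfNorm (evalAt A Ω), fun a ha =>
    LinearMap.extendOfNorm_eq hd hf (⟨a, ha⟩ : A)⟩

/-- A `*`-algebra with a cyclic vector whose vector state is tracial generates a von Neumann
algebra on which the vector state is a faithful normal tracial state. -/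
theorem isFaithfulNormalTracialState_vectorFunctional (S : Set (K →L[ℂ] K)) {Ω : K}
    (hΩ : ‖Ω‖ = 1) (hd : DenseRange (evalAt (StarAlgebra.adjoin ℂ S) Ω))
    (htr : ∀ a ∈ StarAlgebra.adjoin ℂ S, ∀ b ∈ StarAlgebra.adjoin ℂ S,
      ⟪Ω, (a * b) Ω⟫_ℂ = ⟪Ω, (b * a) Ω⟫_ℂ) :
    IsFaithfulNormalTracialState (vonNeumannGenerated S)
      (vectorFunctional (vonNeumannGenerated S) Ω) := by
  set A := StarAlgebra.adjoin ℂ S with hA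
  -- elements of the double commutant commute with right multiplications
  have key : ∀ x ∈ (vonNeumannGenerated S).toStarSubalgebra, ∀ b ∈ A, ∃ r : K →L[ℂ] K,
      (∀ a ∈ A, r (a Ω) = (a * b) Ω) ∧ ∀ ξ, x (r ξ) = r (x ξ) := by
    intro x hx b hb
    obtain ⟨r, hr⟩ := exists_rightMul hd htr hb
    have hcomm : ∀ s ∈ A, s * r = r * s := fun s hs => by
      refine ext_operator_of_dense hd fun a ha => ?_
      simp only [mul_apply_eq_comp, hr a ha]
      have := hr _ (mul_mem hs ha)
      simp only [mul_apply_eq_comp] at this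
      exact this.symm
    have hrmem : r ∈ StarSubalgebra.centralizer ℂ S := by
      rw [StarSubalgebra.mem_centralizer_iff]
      exact fun s hs => ⟨hcomm s (StarAlgebra.subset_adjoin ℂ S hs),
        hcomm _ (star_mem (StarAlgebra.subset_adjoin ℂ S hs))⟩
    have hxr := ((StarSubalgebra.mem_centralizer_iff ℂ).1
      (show x ∈ StarSubalgebra.centralizer ℂ
        (StarSubalgebra.centralizer ℂ S : Set (K →L[ℂ] K)) from hx) r hrmem).1
    exact ⟨r, hr, fun ξ => (DFunLike.congr_fun hxr ξ).symm⟩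
  have hΩmem : (1 : K →L[ℂ] K) ∈ A := one_mem A
  -- This is ⟪Ω, xaΩ⟫ = ⟪Ω, axΩ⟫: replace aΩ by rΩ, move r past x, and use r*Ω = a*Ω.
  have flip : ∀ x ∈ (vonNeumannGenerated S).toStarSubalgebra, ∀ a ∈ A,
      ⟪star x Ω, a Ω⟫_ℂ = ⟪star a Ω, x Ω⟫_ℂ := by
    intro x hx a ha
    obtain ⟨r, hr, hxr⟩ := key x hx a ha
    have hrΩ : r Ω = a Ω := by simpa using hr 1 hΩmem
    have hrs : star r Ω = star a Ω := by
      refine ext_of_dense hd fun b hb => ?_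
      rw [inner_star_apply, hr b hb, inner_star_apply, htr b hb a ha]
      rfl
    rw [← hrΩ, inner_star_apply, hxr, ← inner_star_apply, hrs]
  have hnorm : ∀ x ∈ (vonNeumannGenerated S).toStarSubalgebra, ‖star x Ω‖ ≤ ‖x Ω‖ := by
    intro x hx
    by_contra! hlt
    -- On the dense set of vectors aΩ this is `flip` with Cauchy–Schwarz; taking ξ = x*Ω then bounds
    -- ‖x*Ω‖.
    have hall : ∀ ξ : K, ‖⟪star x Ω, ξ⟫_ℂ‖ ≤ ‖x Ω‖ * ‖ξ‖ := by
      intro ξ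
      refine hd.induction_on (p := fun ξ => ‖⟪star x Ω, ξ⟫_ℂ‖ ≤ ‖x Ω‖ * ‖ξ‖) ξ ?_ ?_
      · exact isClosed_le (by fun_prop) (by fun_prop)
      · intro a
        change ‖⟪star x Ω, (a : K →L[ℂ] K) Ω⟫_ℂ‖ ≤ ‖x Ω‖ * ‖(a : K →L[ℂ] K) Ω‖
        rw [flip x hx a a.2, ← norm_star_apply_of_tracial htr a.2, mul_comm]
        exact norm_inner_le_norm _ _
    have h := hall (star x Ω)
    rw [inner_self_eq_norm_sq_to_K] at h
    simp only [norm_pow, RCLike.norm_ofReal, abs_norm] at h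
    nlinarith [norm_nonneg (x Ω)]
  have hnorm' : ∀ x ∈ (vonNeumannGenerated S).toStarSubalgebra, ‖star x Ω‖ = ‖x Ω‖ :=
    fun x hx => le_antisymm (hnorm x hx) (by simpa using hnorm _ (star_mem hx))
  refine ⟨?_, ?_, ?_, ?_, ?_⟩
  · change ⟪Ω, Ω⟫_ℂ = 1
    rw [inner_self_eq_norm_sq_to_K, hΩ]; simp
  · intro x
    change 0 ≤ ⟪Ω, star (x : K →L[ℂ] K) ((x : K →L[ℂ] K) Ω)⟫_ℂ
    rw [inner_apply_star, inner_self_eq_norm_sq_to_K]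
    simp
  · intro x hx
    change ⟪Ω, star (x : K →L[ℂ] K) ((x : K →L[ℂ] K) Ω)⟫_ℂ = 0 at hx
    rw [inner_apply_star, inner_self_eq_zero] at hx
    refine Subtype.ext (ext_operator_of_dense hd fun a ha => ?_)
    obtain ⟨r, hr, hxr⟩ := key x x.2 a ha
    have hrΩ : r Ω = a Ω := by simpa using hr 1 hΩmem
    rw [← hrΩ, hxr, hx]; simp
  · intro x y
    change ⟪Ω, (x : K →L[ℂ] K) ((y : K →L[ℂ] K) Ω)⟫_ℂ
      = ⟪Ω, (y : K →L[ℂ] K) ((x : K →L[ℂ] K) Ω)⟫_ℂ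
    rw [← inner_star_apply (x : K →L[ℂ] K) Ω, ← inner_star_apply (y : K →L[ℂ] K) Ω, ← inner_conj_symm _ ((x : K →L[ℂ] K) Ω),
      inner_eq_sum_norm_sq_div_four, inner_eq_sum_norm_sq_div_four ((x : K →L[ℂ] K) Ω)]
    -- Polarization reduces traciality to equalities of norms, which are `hnorm'` for x + c̄ y* with
    -- c = ±1, ±i.
    have e : ∀ c : ℂ, ‖star (x : K →L[ℂ] K) Ω + c • (y : K →L[ℂ] K) Ω‖
        = ‖(x : K →L[ℂ] K) Ω + (starRingEnd ℂ c) • star (y : K →L[ℂ] K) Ω‖ := by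
      intro c
      have := hnorm' (x + (starRingEnd ℂ c) • star (y : K →L[ℂ] K))
        (add_mem x.2 (SMulMemClass.smul_mem _ (star_mem y.2)))
      simpa using this
    have e1 := e 1
    have e2 := e (-1)
    have e3 := e Complex.I
    have e4 := e (-Complex.I)
    simp only [one_smul, neg_smul, map_one, map_neg, Complex.conj_I, neg_neg, ← sub_eq_add_neg]
      at e1 e2 e3 e4
    simp only [RCLike.I_to_complex, e1, e2, e3, e4]
    simp [show (starRingEnd ℂ) 4 = 4 from map_ofNat (starRingEnd ℂ) 4]
    ring
  · refine ⟨fun k => if k = 0 then Ω else 0, fun k => if k = 0 then Ω else 0, ?_, ?_, fun x => ?_⟩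
    · exact summable_of_ne_finset_zero (s := {0}) (by simp +contextual)
    · exact summable_of_ne_finset_zero (s := {0}) (by simp +contextual)
    · convert hasSum_single (f := fun k : ℕ => ⟪(if k = 0 then Ω else 0 : K),
        (x : K →L[ℂ] K) (if k = 0 then Ω else 0)⟫_ℂ) 0 (by simp +contextual) using 1
      simp [vectorFunctional]

end VectorState

/-! ### Alternating products of centred elements -/

section Free

variable {A ι : Type*} [Ring A] [StarRing A] [Algebra ℂ A] [StarModule ℂ A]

/-- `AltCentred τ B i x` means that `x` is a nonempty alternating product of elements of trace
zero of the subalgebras `B j`, the first factor being in `B i`. -/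
inductive AltCentred (τ : A →ₗ[ℂ] ℂ) (B : ι → StarSubalgebra ℂ A) : ι → A → Prop
  | single {i : ι} {a : A} (ha : a ∈ B i) (h0 : τ a = 0) : AltCentred τ B i a
  | cons {i j : ι} {a x : A} (ha : a ∈ B i) (h0 : τ a = 0) (hij : i ≠ j)
      (hx : AltCentred τ B j x) : AltCentred τ B i (a * x)

variable {τ : A →ₗ[ℂ] ℂ} {B : ι → StarSubalgebra ℂ A}

lemma AreFree.apply_eq_zero (h : AreFree τ B) {i : ι} {x : A} (hx : AltCentred τ B i x) :
    τ x = 0 := by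
  suffices H : ∃ (m : ℕ) (f : Fin (m + 1) → ι) (a : Fin (m + 1) → A),
      (∀ k, a k ∈ B (f k)) ∧ (∀ k, τ (a k) = 0) ∧ (∀ k : Fin m, f k.castSucc ≠ f k.succ) ∧
      f 0 = i ∧ (List.ofFn a).prod = x by
    obtain ⟨m, f, a, h1, h2, h3, -, rfl⟩ := H
    exact h m f a h1 h2 h3
  induction hx with
  | @single i a ha h0 => exact ⟨0, fun _ => i, fun _ => a, fun _ => ha, fun _ => h0,
      fun k => k.elim0, rfl, by simp⟩
  | @cons i j a x ha h0 hij hx ih =>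
    obtain ⟨m, f, b, h1, h2, h3, rfl, rfl⟩ := ih
    refine ⟨m + 1, Fin.cons i f, Fin.cons a b, ?_, ?_, ?_, rfl, ?_⟩
    · exact Fin.cases (by simpa using ha) (fun k => by simpa using h1 k)
    · exact Fin.cases (by simpa using h0) (fun k => by simpa using h2 k)
    · refine Fin.cases (by simpa using hij) fun k => ?_
      rw [Fin.castSucc_succ, Fin.cons_succ, Fin.cons_succ]
      exact h3 k
    · rw [List.ofFn_succ]
      simp

lemma altCentred_ofFn (m : ℕ) (f : Fin (m + 1) → ι) (a : Fin (m + 1) → A)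
    (h1 : ∀ k, a k ∈ B (f k)) (h2 : ∀ k, τ (a k) = 0)
    (h3 : ∀ k : Fin m, f k.castSucc ≠ f k.succ) :
    AltCentred τ B (f 0) (List.ofFn a).prod := by
  induction m with
  | zero => simpa using .single (h1 0) (h2 0)
  | succ m ih =>
    rw [List.ofFn_succ, List.prod_cons]
    exact .cons (h1 0) (h2 0) (h3 0) (ih (fun k => f k.succ) (fun k => a k.succ)
      (fun k => h1 _) (fun k => h2 _) fun k => h3 k.succ)

/-- The span of `1` and the alternating products of centred elements. -/
def altSpan (τ : A →ₗ[ℂ] ℂ) (B : ι → StarSubalgebra ℂ A) : Submodule ℂ A :=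
  Submodule.span ℂ ({1} ∪ {x | ∃ i, AltCentred τ B i x})

lemma sub_trace_mem (i : ι) {a : A} (ha : a ∈ B i) : a - τ a • 1 ∈ B i :=
  sub_mem ha (SMulMemClass.smul_mem _ (one_mem _))

omit [StarRing A] [StarModule ℂ A] in
lemma trace_sub_trace (hτ : τ 1 = 1) (a : A) : τ (a - τ a • 1) = 0 := by simp [hτ]

omit [StarRing A] [StarModule ℂ A] in
lemma eq_sub_trace_add (a : A) : a = (a - τ a • 1) + τ a • 1 := by abel

/-- Merge `a` with the leading factor if both lie in the same algebra, and split the result into a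
centred part and a scalar. -/
lemma mul_mem_altSpan (hτ : τ 1 = 1) {i : ι} {a x : A} (ha : a ∈ B i) (hx : x ∈ altSpan τ B) :
    a * x ∈ altSpan τ B := by
  have one : (1 : A) ∈ altSpan τ B := Submodule.subset_span (Or.inl rfl)
  have alt : ∀ {j y}, AltCentred τ B j y → y ∈ altSpan τ B :=
    fun h => Submodule.subset_span (Or.inr ⟨_, h⟩)
  have mem : ∀ {j b}, b ∈ B j → b ∈ altSpan τ B := fun {j b} hb => by
    rw [eq_sub_trace_add (τ := τ) b]
    exact add_mem (alt (.single (sub_trace_mem j hb) (trace_sub_trace hτ b)))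
      (Submodule.smul_mem _ _ one)
  refine Submodule.span_induction ?_ ?_ ?_ ?_ hx
  · rintro y (rfl | ⟨j, hy⟩)
    · simpa using mem ha
    · by_cases hij : i = j
      · subst hij
        cases hy with
        | single hb _ => exact mem (mul_mem ha hb)
        | @cons _ k b z hb hb0 hik hz =>
          rw [← mul_assoc, eq_sub_trace_add (τ := τ) (a * b), add_mul, smul_one_mul]
          exact add_mem (alt (.cons (sub_trace_mem i (mul_mem ha hb)) (trace_sub_trace hτ _) hik hz))
            (Submodule.smul_mem _ _ (alt hz))
      · rw [eq_sub_trace_add (τ := τ) a, add_mul, smul_one_mul]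
        exact add_mem (alt (.cons (sub_trace_mem i ha) (trace_sub_trace hτ a) hij hy))
          (Submodule.smul_mem _ _ (alt hy))
  · simp
  · intro y z _ _ hy hz
    rw [mul_add]; exact add_mem hy hz
  · intro c y _ hy
    rw [mul_smul_comm]; exact Submodule.smul_mem _ _ hy

lemma adjoin_le_altSpan (hτ : τ 1 = 1) {x : A} (hx : x ∈ Algebra.adjoin ℂ (⋃ i, (B i : Set A))) :
    x ∈ altSpan τ B := by
  suffices H : ∀ y ∈ altSpan τ B, x * y ∈ altSpan τ B by
    simpa using H 1 (Submodule.subset_span (Or.inl rfl))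
  induction hx using Algebra.adjoin_induction with
  | mem x hx =>
    obtain ⟨i, hi⟩ := Set.mem_iUnion.1 hx
    exact fun y hy => mul_mem_altSpan hτ hi hy
  | algebraMap r =>
    intro y hy
    rw [← Algebra.smul_def]; exact Submodule.smul_mem _ _ hy
  | add x y _ _ hx hy => intro z hz; rw [add_mul]; exact add_mem (hx z hz) (hy z hz)
  | mul x y _ _ hx hy => intro z hz; rw [mul_assoc]; exact hx _ (hy z hz)

/-- The span of the alternating products of centred elements with first factor in `B i`. -/
def altSpanAt (τ : A →ₗ[ℂ] ℂ) (B : ι → StarSubalgebra ℂ A) (i : ι) : Submodule ℂ A :=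
  Submodule.span ℂ {x | AltCentred τ B i x}

lemma AltCentred.mem_altSpanAt {i : ι} {x : A} (hx : AltCentred τ B i x) : x ∈ altSpanAt τ B i :=
  Submodule.subset_span hx

lemma mul_mem_altSpanAt {i j : ι} {a x : A} (ha : a ∈ B i) (h0 : τ a = 0) (hij : i ≠ j)
    (hx : x ∈ altSpanAt τ B j) : a * x ∈ altSpanAt τ B i := by
  refine Submodule.span_induction ?_ ?_ ?_ ?_ hx
  · exact fun y hy => (AltCentred.cons ha h0 hij hy).mem_altSpanAt
  · simp
  · intro y z _ _ hy hz
    rw [mul_add]; exact add_mem hy hz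
  · intro c y _ hy
    rw [mul_smul_comm]; exact Submodule.smul_mem _ _ hy

lemma apply_eq_zero_of_mem_altSpanAt (hfree : ∀ {i x}, AltCentred τ B i x → τ x = 0) {i : ι}
    {x : A} (hx : x ∈ altSpanAt τ B i) : τ x = 0 :=
  (Submodule.span_le (p := LinearMap.ker τ)).2 (fun _ hy => hfree hy) hx

/-- Right multiplication by `b` acts at the far end of the word. Since there are at least two
factors, the leading centred factor `a` survives, so the trace remains zero. -/
lemma AltCentred.cons_mul_mem (hτ : τ 1 = 1) {i j k : ι} {a b x : A} (ha : a ∈ B i)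
    (h0 : τ a = 0) (hij : i ≠ j) (hx : AltCentred τ B j x) (hb : b ∈ B k) :
    a * x * b ∈ altSpanAt τ B i := by
  -- A scalar term appears only when `x` is a single factor that merges with `b`; multiplied by `a`,
  -- it becomes a multiple of `a`.
  have key : ∃ c : ℂ, x * b - c • 1 ∈ altSpanAt τ B j := by
    induction hx generalizing i a with
    | @single j y hy hy0 =>
      by_cases hjk : j = k
      · subst hjk
        exact ⟨τ (y * b), (AltCentred.single (sub_trace_mem j (mul_mem hy hb))
          (trace_sub_trace hτ _)).mem_altSpanAt⟩
      · refine ⟨0, ?_⟩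
        rw [zero_smul, sub_zero, eq_sub_trace_add (τ := τ) b, mul_add, mul_smul_one]
        exact add_mem (AltCentred.cons hy hy0 hjk
          (.single (sub_trace_mem k hb) (trace_sub_trace hτ b))).mem_altSpanAt
          (Submodule.smul_mem _ _ (AltCentred.single hy hy0).mem_altSpanAt)
    | @cons j l y z hy hy0 hjl hz ih =>
      obtain ⟨c, hc⟩ := ih hy hy0 hjl
      refine ⟨0, ?_⟩
      have e : y * z * b - (0 : ℂ) • 1 = y * (z * b - c • 1) + c • y := by
        rw [mul_sub, mul_smul_one, mul_assoc, zero_smul]; abel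
      rw [e]
      exact add_mem (mul_mem_altSpanAt hy hy0 hjl hc)
        (Submodule.smul_mem _ _ (AltCentred.single hy hy0).mem_altSpanAt)
  obtain ⟨c, hc⟩ := key
  have e : a * x * b = a * (x * b - c • 1) + c • a := by
    rw [mul_sub, mul_smul_one, mul_assoc]; abel
  rw [e]
  exact add_mem (mul_mem_altSpanAt ha h0 hij hc)
    (Submodule.smul_mem _ _ (AltCentred.single ha h0).mem_altSpanAt)

/-- The free product of tracial functionals is tracial. -/
theorem tracial_of_free (hτ : τ 1 = 1) (hfree : ∀ {i x}, AltCentred τ B i x → τ x = 0)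
    (htr : ∀ i, ∀ a ∈ B i, ∀ b ∈ B i, τ (a * b) = τ (b * a)) {x y : A}
    (hx : x ∈ Algebra.adjoin ℂ (⋃ i, (B i : Set A)))
    (hy : y ∈ Algebra.adjoin ℂ (⋃ i, (B i : Set A))) : τ (x * y) = τ (y * x) := by
  -- It suffices to move one generator cyclically. For words `z` of length at least two, both traces
  -- vanish.
  have gen : ∀ i, ∀ a ∈ B i, ∀ z ∈ altSpan τ B, τ (a * z) = τ (z * a) := by
    intro i a ha z hz
    refine Submodule.span_induction ?_ ?_ ?_ ?_ hz
    · rintro z (rfl | ⟨j, hz⟩)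
      · simp
      cases hz with
      | single hb hb0 =>
        by_cases hij : i = j
        · subst hij; exact htr i _ ha _ hb
        · have h1 := hfree (AltCentred.cons (sub_trace_mem i ha) (trace_sub_trace hτ a) hij
            (.single hb hb0))
          have h2 := hfree (AltCentred.cons hb hb0 (Ne.symm hij)
            (.single (sub_trace_mem i ha) (trace_sub_trace hτ a)))
          rw [sub_mul, smul_one_mul, map_sub, map_smul, hb0, smul_zero, sub_zero] at h1
          rw [mul_sub, mul_smul_one, map_sub, map_smul, hb0, smul_zero, sub_zero] at h2
          rw [h1, h2]
      | @cons _ k b w hb hb0 hjk hw =>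
        rw [apply_eq_zero_of_mem_altSpanAt hfree (AltCentred.cons_mul_mem hτ hb hb0 hjk hw ha)]
        by_cases hij : i = j
        · subst hij
          rw [← mul_assoc, eq_sub_trace_add (τ := τ) (a * b), add_mul, smul_one_mul, map_add,
            map_smul, hfree hw, hfree (.cons (sub_trace_mem i (mul_mem ha hb))
              (trace_sub_trace hτ _) hjk hw)]
          simp
        · rw [eq_sub_trace_add (τ := τ) a, add_mul, smul_one_mul, map_add,
            map_smul, hfree (.cons hb hb0 hjk hw), hfree (.cons (sub_trace_mem i ha)
              (trace_sub_trace hτ _) hij (.cons hb hb0 hjk hw))]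
          simp
    · simp
    · intro z w _ _ hz hw
      rw [mul_add, add_mul, map_add, map_add, hz, hw]
    · intro c z _ hz
      rw [mul_smul_comm, smul_mul_assoc, map_smul, map_smul, hz]
  induction hx using Algebra.adjoin_induction generalizing y with
  | mem x hx =>
    obtain ⟨i, hi⟩ := Set.mem_iUnion.1 hx
    exact gen i x hi y (adjoin_le_altSpan hτ hy)
  | algebraMap r => rw [Algebra.commutes]
  | add x z _ _ hx hz => rw [add_mul, mul_add, map_add, map_add, hx hy, hz hy]
  | mul x z hx' hz' hx hz =>
    rw [mul_assoc, hx (mul_mem hz' hy), mul_assoc, hz (mul_mem hy hx'), mul_assoc]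

end Free

/-! ### Amplification of operators along an orthogonal family of isometries -/

section Amplification

lemma lp_norm_sq {T G : Type*} [NormedAddCommGroup G] (f : lp (fun _ : T => G) 2) :
    ‖f‖ ^ 2 = ∑' t, ‖f t‖ ^ 2 := by
  simpa using lp.norm_rpow_eq_tsum (p := 2) (by norm_num) f

lemma lp_summable_sq {T G : Type*} [NormedAddCommGroup G] (f : lp (fun _ : T => G) 2) :
    Summable fun t => ‖f t‖ ^ 2 := by
  simpa using (lp.memℓp f).summable (by norm_num)

variable {T G K : Type*} [NormedAddCommGroup G] [InnerProductSpace ℂ G] [CompleteSpace G]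
  [NormedAddCommGroup K] [InnerProductSpace ℂ K] [CompleteSpace K]

/-- The diagonal operator on `ℓ²(T; G)` with all entries equal to `a`. -/
noncomputable def diagonalOperator (T : Type*) (a : G →L[ℂ] G) :
    lp (fun _ : T => G) 2 →L[ℂ] lp (fun _ : T => G) 2 :=
  LinearMap.mkContinuous
    { toFun := fun f => ⟨fun t => a (f t), memℓp_gen (by
        refine Summable.of_nonneg_of_le (fun t => by positivity) (fun t => ?_)
          ((lp_summable_sq f).mul_left (‖a‖ ^ 2))
        rw [← mul_pow]
        simpa using pow_le_pow_left₀ (norm_nonneg _) (a.le_opNorm (f t)) 2)⟩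
      map_add' := fun f g => lp.ext (funext fun t => a.map_add _ _)
      map_smul' := fun c f => lp.ext (funext fun t => a.map_smul c _) }
    ‖a‖ (fun f => by
      refine (sq_le_sq₀ (norm_nonneg _) (by positivity)).1 ?_
      rw [mul_pow, lp_norm_sq, lp_norm_sq, ← tsum_mul_left]
      refine Summable.tsum_le_tsum (fun t => ?_) (lp_summable_sq _) ((lp_summable_sq f).mul_left _)
      rw [← mul_pow]
      exact pow_le_pow_left₀ (norm_nonneg _) (a.le_opNorm (f t)) 2)

/-- The diagonal `*`-representation of `B(G)` on `ℓ²(T; G)`. -/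
noncomputable def diagonalHom (T : Type*) (G : Type*) [NormedAddCommGroup G]
    [InnerProductSpace ℂ G] [CompleteSpace G] :
    (G →L[ℂ] G) →⋆ₐ[ℂ] (lp (fun _ : T => G) 2 →L[ℂ] lp (fun _ : T => G) 2) where
  toFun := diagonalOperator T
  map_one' := rfl
  map_mul' _ _ := rfl
  map_zero' := rfl
  map_add' _ _ := rfl
  commutes' _ := rfl
  map_star' a := by
    refine (ContinuousLinearMap.eq_adjoint_iff _ _).2 fun f g => ?_
    rw [lp.inner_eq_tsum, lp.inner_eq_tsum]
    exact tsum_congr fun t => ContinuousLinearMap.adjoint_inner_left a _ _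

/-- The amplification of operators on `G` to an orthogonal sum of copies of `G`. -/
noncomputable def amplification {V : T → G →ₗᵢ[ℂ] K} (hV : IsHilbertSum ℂ (fun _ => G) V) :
    (G →L[ℂ] G) →⋆ₐ[ℂ] (K →L[ℂ] K) :=
  hV.linearIsometryEquiv.symm.conjStarAlgEquiv.toStarAlgHom.comp (diagonalHom T G)

lemma amplification_apply {V : T → G →ₗᵢ[ℂ] K} (hV : IsHilbertSum ℂ (fun _ => G) V)
    (a : G →L[ℂ] G) (t : T) (ξ : G) : amplification hV a (V t ξ) = V t (a ξ) := by
  classical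
  change hV.linearIsometryEquiv.symm (diagonalOperator T a (hV.linearIsometryEquiv (V t ξ))) = _
  rw [← hV.linearIsometryEquiv_symm_apply_single (a ξ), ← hV.linearIsometryEquiv_symm_apply_single ξ,
    LinearIsometryEquiv.apply_symm_apply]
  congr 1
  refine lp.ext (funext fun s => ?_)
  change a _ = _
  by_cases h : s = t
  · subst h; simp
  · simp [h]

end Amplification

/-! ### Embeddings between `ℓ²`-spaces -/

section Embedding

open Classical in
/-- The standard basis vector of `ℓ²(X)`. -/
noncomputable def basisVec {X : Type*} (x : X) : lp (fun _ : X => ℂ) 2 := lp.single 2 x 1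

variable {X Y : Type*}

lemma inner_basisVec_left (x : X) (f : lp (fun _ : X => ℂ) 2) : ⟪basisVec x, f⟫_ℂ = f x := by
  classical
  rw [basisVec, show (fun a b => Classical.propDecidable (a = b)) =
    (inferInstance : DecidableEq X) from Subsingleton.elim _ _, lp.inner_single_left]
  simp

lemma basisVec_apply_self (x : X) : (basisVec x : X → ℂ) x = 1 := by
  simp [basisVec]

lemma basisVec_apply_ne {x y : X} (h : y ≠ x) : (basisVec x : X → ℂ) y = 0 := by
  simp [basisVec, h]

lemma norm_basisVec (x : X) : ‖basisVec x‖ = 1 := by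
  simp [basisVec, lp.norm_single]

lemma hasSum_basisVec (f : lp (fun _ : X => ℂ) 2) : HasSum (fun x => f x • basisVec x) f := by
  classical
  have := lp.hasSum_single (p := 2) (by norm_num) f
  refine this.congr_fun fun x => ?_
  rw [basisVec, ← lp.single_smul]
  simp

lemma orthonormal_basisVec_comp {j : X → Y} (hj : Function.Injective j) :
    Orthonormal ℂ fun x => basisVec (j x) := by
  refine ⟨fun x => norm_basisVec _, fun x y hxy => ?_⟩
  change ⟪_, _⟫_ℂ = 0
  rw [inner_basisVec_left, basisVec_apply_ne]
  exact fun h => hxy (hj h)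

/-- The isometry `ℓ²(X) → ℓ²(Y)` induced by an injective map. -/
noncomputable def lpEmb {j : X → Y} (hj : Function.Injective j) :
    lp (fun _ : X => ℂ) 2 →ₗᵢ[ℂ] lp (fun _ : Y => ℂ) 2 :=
  (orthonormal_basisVec_comp hj).orthogonalFamily.linearIsometry

lemma hasSum_lpEmb {j : X → Y} (hj : Function.Injective j) (f : lp (fun _ : X => ℂ) 2) :
    HasSum (fun x => f x • basisVec (j x)) (lpEmb hj f) :=
  (orthonormal_basisVec_comp hj).orthogonalFamily.hasSum_linearIsometry f

lemma lpEmb_basisVec {j : X → Y} (hj : Function.Injective j) (x : X) :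
    lpEmb hj (basisVec x) = basisVec (j x) := by
  classical
  refine (hasSum_lpEmb hj (basisVec x)).unique ?_
  convert hasSum_single (f := fun y => (basisVec x : X → ℂ) y • basisVec (j y)) x ?_ using 1
  · rw [basisVec_apply_self, one_smul]
  · intro y hy
    rw [basisVec_apply_ne hy, zero_smul]

lemma lpEmb_apply_notMem {j : X → Y} (hj : Function.Injective j) (f : lp (fun _ : X => ℂ) 2)
    {y : Y} (hy : y ∉ Set.range j) : (lpEmb hj f : Y → ℂ) y = 0 := by
  rw [← inner_basisVec_left]
  refine ((hasSum_lpEmb hj f).mapL (innerSL ℂ (basisVec y))).unique ?_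
  refine (hasSum_zero (α := ℂ) (β := X)).congr_fun fun x => ?_
  rw [innerSL_apply_apply, inner_smul_right, inner_basisVec_left, basisVec_apply_ne, mul_zero]
  exact fun h => hy ⟨x, h.symm⟩

lemma inner_lpEmb_of_disjoint {X' : Type*} {j : X → Y} (hj : Function.Injective j) {j' : X' → Y}
    (hj' : Function.Injective j') (h : ∀ x x', j x ≠ j' x') (f : lp (fun _ : X => ℂ) 2)
    (g : lp (fun _ : X' => ℂ) 2) : ⟪lpEmb hj f, lpEmb hj' g⟫_ℂ = 0 := by
  rw [lp.inner_eq_tsum]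
  refine (tsum_congr fun y => ?_).trans tsum_zero
  by_cases hy : y ∈ Set.range j
  · obtain ⟨x, rfl⟩ := hy
    rw [lpEmb_apply_notMem hj' g (y := j x) (by rintro ⟨x', h'⟩; exact h x x' h'.symm)]
    simp
  · rw [lpEmb_apply_notMem hj f hy]
    simp

/-- If `ζ` vanishes on the image of `j` outside `j x₀`, then only the coordinate at `x₀`
contributes to the inner product with `ζ`. -/
lemma inner_lpEmb_left {j : X → Y} (hj : Function.Injective j) (f : lp (fun _ : X => ℂ) 2)
    (ζ : lp (fun _ : Y => ℂ) 2) (x₀ : X) (h : ∀ x ≠ x₀, ζ (j x) = 0) :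
    ⟪lpEmb hj f, ζ⟫_ℂ = (starRingEnd ℂ) (f x₀) * ζ (j x₀) := by
  rw [← inner_conj_symm]
  have h1 := (hasSum_lpEmb hj f).mapL (innerSL ℂ ζ)
  have h2 := hasSum_single (f := fun x => innerSL ℂ ζ (f x • basisVec (j x))) x₀ (fun x hx => by
    rw [innerSL_apply_apply, inner_smul_right, ← inner_conj_symm, inner_basisVec_left, h x hx]
    simp)
  rw [show ⟪ζ, lpEmb hj f⟫_ℂ = _ from h1.unique h2, innerSL_apply_apply, inner_smul_right,
    ← inner_conj_symm, inner_basisVec_left]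
  simp

end Embedding

/-! ### The free product Hilbert space -/

section FockSpace

open Monoid.CoprodI

variable {ι : Type*} {S : ι → Type*} [∀ i, Monoid (S i)]

open Classical in
lemma rcons_head_injective {i : ι} {w : Word S} (hw : w.fstIdx ≠ some i) :
    Function.Injective fun s : S i => Word.rcons ⟨s, w, hw⟩ := fun s t h => by
  simpa using Word.rcons_inj h

open Classical in
/-- The isometry `ℓ²(S i) → ℓ²(Word S)` which prepends letters to a given word. -/
noncomputable def prependIsometry (i : ι) (w : {w : Word S // w.fstIdx ≠ some i}) :
    lp (fun _ : S i => ℂ) 2 →ₗᵢ[ℂ] lp (fun _ : Word S => ℂ) 2 :=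
  lpEmb (rcons_head_injective w.2)

open Classical in
lemma prependIsometry_basisVec (i : ι) (w : {w : Word S // w.fstIdx ≠ some i}) (s : S i) :
    prependIsometry i w (basisVec s) = basisVec (Word.rcons ⟨s, w.1, w.2⟩) :=
  lpEmb_basisVec _ s

lemma prependIsometry_basisVec_one (i : ι) (w : {w : Word S // w.fstIdx ≠ some i}) :
    prependIsometry i w (basisVec 1) = basisVec w.1 := by
  classical
  rw [prependIsometry_basisVec]
  simp [Word.rcons]

/-- Every word is, in exactly one way, a possibly trivial letter of `S i` followed by a word not
beginning in `S i`; `Word.rcons` leaves the word alone when the letter is `1`. -/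
lemma isHilbertSum_prependIsometry (i : ι) :
    IsHilbertSum ℂ (fun _ => lp (fun _ : S i => ℂ) 2) (prependIsometry (S := S) i) := by
  classical
  refine IsHilbertSum.mk (fun w w' hww' f g => ?_) fun f _ => ?_
  · refine inner_lpEmb_of_disjoint _ _ (fun s s' h => hww' ?_) f g
    have := Word.rcons_inj h
    simp only [Word.Pair.mk.injEq] at this
    exact Subtype.ext this.2
  · refine (Submodule.isClosed_topologicalClosure _).mem_of_tendsto (hasSum_basisVec f)
      (Filter.Eventually.of_forall fun F => Submodule.le_topologicalClosure _
        (Submodule.sum_mem _ fun w _ => Submodule.smul_mem _ _ ?_))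
    obtain ⟨⟨s, t, ht⟩, rfl⟩ := (Word.equivPair i).symm.surjective w
    exact Submodule.mem_iSup_of_mem ⟨t, ht⟩ ⟨basisVec s, prependIsometry_basisVec i ⟨t, ht⟩ s⟩

/-- The left action of the operators on `ℓ²(S i)` on the free product space `ℓ²(Word S)`. -/
noncomputable def freeRep (i : ι) : (lp (fun _ : S i => ℂ) 2 →L[ℂ] lp (fun _ : S i => ℂ) 2) →⋆ₐ[ℂ]
    (lp (fun _ : Word S => ℂ) 2 →L[ℂ] lp (fun _ : Word S => ℂ) 2) :=
  amplification (isHilbertSum_prependIsometry i)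

lemma freeRep_prependIsometry (i : ι) (a : lp (fun _ : S i => ℂ) 2 →L[ℂ] lp (fun _ : S i => ℂ) 2)
    (w : {w : Word S // w.fstIdx ≠ some i}) (ξ : lp (fun _ : S i => ℂ) 2) :
    freeRep i a (prependIsometry i w ξ) = prependIsometry i w (a ξ) :=
  amplification_apply _ a w ξ

/-- The vacuum vector of the free product space. -/
noncomputable def vacuum (S : ι → Type*) [∀ i, Monoid (S i)] : lp (fun _ : Word S => ℂ) 2 :=
  basisVec Word.empty

lemma vacuum_eq (i : ι) : vacuum S = prependIsometry i ⟨Word.empty, by simp [Word.fstIdx]⟩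
    (basisVec 1) := (prependIsometry_basisVec_one i ⟨Word.empty, by simp [Word.fstIdx]⟩).symm

lemma inner_vacuum_freeRep (i : ι)
    (a : lp (fun _ : S i => ℂ) 2 →L[ℂ] lp (fun _ : S i => ℂ) 2) :
    ⟪vacuum S, freeRep i a (vacuum S)⟫_ℂ = ⟪basisVec 1, a (basisVec 1)⟫_ℂ := by
  rw [vacuum_eq i, freeRep_prependIsometry, LinearIsometry.inner_map_map]

/-- Vectors supported on the words whose first letter is in `S i`. -/
def SupportedAt (i : ι) (ζ : lp (fun _ : Word S => ℂ) 2) : Prop :=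
  ∀ w : Word S, w.fstIdx ≠ some i → ζ w = 0

open Classical in
lemma fstIdx_rcons {i : ι} {w : Word S} (hw : w.fstIdx ≠ some i) {s : S i} (hs : s ≠ 1) :
    (Word.rcons ⟨s, w, hw⟩).fstIdx = some i := by
  simp [Word.rcons, hs]

-- In the copy of ℓ²(S i) attached to a word w not beginning in `S i`, the vector ζ has only the
-- component ζ(w) δ₁, and aδ₁ is orthogonal to δ₁.
open Classical in
lemma supportedAt_freeRep {i : ι} {a : lp (fun _ : S i => ℂ) 2 →L[ℂ] lp (fun _ : S i => ℂ) 2}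
    (ha : ⟪basisVec 1, a (basisVec 1)⟫_ℂ = 0) {ζ : lp (fun _ : Word S => ℂ) 2}
    (hζ : ∀ w : Word S, w.fstIdx = some i → ζ w = 0) : SupportedAt i (freeRep i a ζ) := by
  intro w hw
  rw [← inner_basisVec_left, ← inner_star_apply, ← map_star,
    ← prependIsometry_basisVec_one i ⟨w, hw⟩, freeRep_prependIsometry, prependIsometry,
    inner_lpEmb_left _ _ _ 1 fun s hs => hζ _ (fstIdx_rcons hw hs), ← inner_basisVec_left,
    inner_conj_symm, inner_star_apply, ha, zero_mul]

/-- The vacuum state on the operators on the free product space. -/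
noncomputable def vacuumState (S : ι → Type*) [∀ i, Monoid (S i)] :
    (lp (fun _ : Word S => ℂ) 2 →L[ℂ] lp (fun _ : Word S => ℂ) 2) →ₗ[ℂ] ℂ where
  toFun x := ⟪vacuum S, x (vacuum S)⟫_ℂ
  map_add' x y := by simp
  map_smul' c x := by simp

/-- The left actions are free with respect to the vacuum state. -/
lemma vacuumState_eq_zero_of_altCentred {i : ι}
    {x : lp (fun _ : Word S => ℂ) 2 →L[ℂ] lp (fun _ : Word S => ℂ) 2}
    (hx : AltCentred (vacuumState S) (fun i => (freeRep (S := S) i).range) i x) :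
    vacuumState S x = 0 := by
  suffices H : SupportedAt i (x (vacuum S)) by
    have := H Word.empty (by simp [Word.fstIdx])
    rwa [← inner_basisVec_left] at this
  induction hx with
  | @single i y hy h0 =>
    obtain ⟨a, rfl⟩ := hy
    refine supportedAt_freeRep ((inner_vacuum_freeRep i a).symm.trans h0) fun w hw => ?_
    refine basisVec_apply_ne ?_
    rintro rfl
    simp [Word.fstIdx] at hw
  | @cons i j y x hy h0 hij hx ih =>
    obtain ⟨a, rfl⟩ := hy
    refine supportedAt_freeRep ((inner_vacuum_freeRep i a).symm.trans h0) fun w hw => ih w ?_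
    rw [hw]
    simpa using hij

/-- If each of the vectors `basisVec 1` is cyclic for a `*`-algebra of operators on `ℓ²(S i)`, then
the vacuum is cyclic for every algebra containing these algebras. -/
lemma denseRange_evalAt_vacuum
    {A : StarSubalgebra ℂ (lp (fun _ : Word S => ℂ) 2 →L[ℂ] lp (fun _ : Word S => ℂ) 2)}
    (h : ∀ i, Dense {ξ | ∃ a, freeRep (S := S) i a ∈ A ∧ a (basisVec 1) = ξ}) :
    DenseRange (evalAt A (vacuum S)) := by
  classical
  set E := (LinearMap.range (evalAt A (vacuum S))).topologicalClosure with hE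
  have hAE : ∀ a ∈ A, ∀ ξ ∈ E, a ξ ∈ E := by
    intro a ha ξ hξ
    refine map_mem_closure a.continuous hξ ?_
    rintro _ ⟨b, rfl⟩
    exact ⟨⟨a, ha⟩ * b, rfl⟩
  -- Build `w` letter by letter: in the copy of ℓ²(S i) attached to a tail, operators of `A` send
  -- δ₁, the tail itself, to a dense set of vectors, hence arbitrarily near to any letter.
  have hw : ∀ w : Word S, basisVec w ∈ E := by
    intro w
    induction w using Word.consRecOn with
    | empty => exact Submodule.le_topologicalClosure _ ⟨1, rfl⟩
    | cons i m w h1 h2 ih =>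
      have hm : basisVec (Word.cons m w h1 h2) = prependIsometry i ⟨w, h1⟩ (basisVec m) := by
        rw [prependIsometry_basisVec, Word.rcons, dif_neg h2]
      rw [hm]
      refine (h i).induction (P := fun ξ => prependIsometry i ⟨w, h1⟩ ξ ∈ E) ?_ ?_ (basisVec m)
      · rintro _ ⟨a, ha, rfl⟩
        rw [← freeRep_prependIsometry, prependIsometry_basisVec_one]
        exact hAE _ ha _ ih
      · exact (Submodule.isClosed_topologicalClosure _).preimage (LinearIsometry.continuous _)
  intro f
  exact (Submodule.isClosed_topologicalClosure _).mem_of_tendsto (hasSum_basisVec f)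
      (Filter.Eventually.of_forall fun F =>
        (Submodule.sum_mem E fun w _ => Submodule.smul_mem _ _ (hw w)))

end FockSpace

/-! ### Existence of tracial free products -/

section Existence

open Monoid.CoprodI

universe v₁ v₂ v w

/-- The functional `τ` is the vector state at a basis vector `basisVec 1`, cyclic for a
representation on an `ℓ²`-space with index set in `Type w`. (The multiplication of the index set
plays no role.) -/
def HasCyclicRep {A : Type*} [Ring A] [StarRing A] [Algebra ℂ A] (τ : A →ₗ[ℂ] ℂ) : Prop :=
  ∃ (X : Type w) (_ : Monoid X)
    (π : A →⋆ₐ[ℂ] (lp (fun _ : X => ℂ) 2 →L[ℂ] lp (fun _ : X => ℂ) 2)),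
    (∀ a, ⟪basisVec 1, π a (basisVec 1)⟫_ℂ = τ a) ∧ DenseRange fun a => π a (basisVec 1)

open Classical in
/-- A monoid structure with prescribed unit. -/
noncomputable abbrev pointedMonoid {X : Type*} (p : X) : Monoid X where
  one := p
  mul x y := if x = p then y else x
  mul_assoc x y z := by
    change (if (if x = p then y else x) = p then z else (if x = p then y else x)) =
      if x = p then (if y = p then z else y) else x
    split_ifs <;> simp_all
  one_mul x := if_pos rfl
  mul_one x := by
    change (if x = p then p else x) = x
    split_ifs with h <;> simp [h]

/-- Complete ξ to an orthonormal basis and declare ξ the unit of the index set: the nontrivial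
letters then index a basis of the orthogonal complement of ξ. `ULift` allows factors from different
universes to be brought to a common one. -/
lemma hasCyclicRep_of_vector {A : Type*} [Ring A] [StarRing A] [Algebra ℂ A] {τ : A →ₗ[ℂ] ℂ}
    {G : Type v} [NormedAddCommGroup G] [InnerProductSpace ℂ G] [CompleteSpace G]
    (π : A →⋆ₐ[ℂ] (G →L[ℂ] G)) {ξ : G} (hξ : ‖ξ‖ = 1) (hτ : ∀ a, ⟪ξ, π a ξ⟫_ℂ = τ a)
    (hd : DenseRange fun a => π a ξ) : HasCyclicRep.{max u v} τ := by
  classical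
  have hon : Orthonormal ℂ (Subtype.val : ({ξ} : Set G) → G) := by
    refine ⟨?_, ?_⟩
    · rintro ⟨_, rfl⟩; exact hξ
    · rintro ⟨_, rfl⟩ ⟨_, rfl⟩ h; exact absurd rfl h
  obtain ⟨s, b, hs, hb⟩ := hon.exists_hilbertBasis_extension
  have hon' : Orthonormal ℂ fun x : ULift.{u} s => b x.down :=
    b.orthonormal.comp _ ULift.down_injective
  let b' : HilbertBasis (ULift.{u} s) ℂ G := HilbertBasis.mk hon' (by
    have : (Set.range fun x : ULift.{u} s => b x.down) = Set.range b :=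
      ULift.down_surjective.range_comp b
    rw [this, b.dense_span])
  let p : ULift.{u} s := ⟨⟨ξ, hs rfl⟩⟩
  have hp : b' p = ξ := by
    rw [HilbertBasis.coe_mk]
    exact congrFun hb _
  have hrepr : b'.repr ξ = basisVec p := by
    rw [← hp, b'.repr_self, basisVec]
    congr!
  let := pointedMonoid p
  have hsymm : b'.repr.symm (basisVec 1) = ξ := by
    rw [LinearIsometryEquiv.symm_apply_eq, hrepr]
    rfl
  have key : ∀ a, b'.repr.conjStarAlgEquiv.toStarAlgHom.comp π a (basisVec 1) = b'.repr (π a ξ) := by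
    intro a
    change b'.repr (π a (b'.repr.symm (basisVec 1))) = _
    rw [hsymm]
  refine ⟨ULift.{u} s, inferInstance, b'.repr.conjStarAlgEquiv.toStarAlgHom.comp π, fun a => ?_, ?_⟩
  · rw [key, ← hτ, ← LinearIsometryEquiv.inner_map_map b'.repr, hrepr]
    rfl
  · simp_rw [key]
    exact b'.repr.surjective.denseRange.comp hd b'.repr.continuous

lemma areFree_of_mem {A ι : Type*} [Ring A] [StarRing A] [Algebra ℂ A] [StarModule ℂ A]
    {C : StarSubalgebra ℂ A} {σ : A →ₗ[ℂ] ℂ} {τ : C →ₗ[ℂ] ℂ} (hτ : ∀ x, τ x = σ x)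
    {B : ι → StarSubalgebra ℂ A} {D : ι → StarSubalgebra ℂ C}
    (hD : ∀ i, ∀ x ∈ D i, (x : A) ∈ B i) (hB : ∀ {i x}, AltCentred σ B i x → σ x = 0) :
    AreFree τ D := by
  intro m i a ha h0 hi
  have := hB (altCentred_ofFn (τ := σ) m i (fun k => (a k : A)) (fun k => hD _ _ (ha k))
    (fun k => (hτ _).symm.trans (h0 k)) hi)
  rw [hτ, ← StarSubalgebra.coe_subtype, map_list_prod, List.map_ofFn]
  exact this

variable {H₁ : Type v₁} [NormedAddCommGroup H₁] [InnerProductSpace ℂ H₁] [CompleteSpace H₁]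
  {H₂ : Type v₂} [NormedAddCommGroup H₂] [InnerProductSpace ℂ H₂] [CompleteSpace H₂]

lemma exists_tracialFreeProduct_aux {S : Fin 2 → Type w} [∀ i, Monoid (S i)]
    (M₁ : VonNeumannAlgebra H₁) (τ₁ : M₁.toStarSubalgebra →ₗ[ℂ] ℂ)
    (M₂ : VonNeumannAlgebra H₂) (τ₂ : M₂.toStarSubalgebra →ₗ[ℂ] ℂ)
    (htr₁ : ∀ x y, τ₁ (x * y) = τ₁ (y * x)) (htr₂ : ∀ x y, τ₂ (x * y) = τ₂ (y * x))
    (π₁ : M₁.toStarSubalgebra →⋆ₐ[ℂ] (lp (fun _ : S 0 => ℂ) 2 →L[ℂ] lp (fun _ : S 0 => ℂ) 2))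
    (h₁ : ∀ a, ⟪basisVec 1, π₁ a (basisVec 1)⟫_ℂ = τ₁ a)
    (hd₁ : DenseRange fun a => π₁ a (basisVec 1))
    (π₂ : M₂.toStarSubalgebra →⋆ₐ[ℂ] (lp (fun _ : S 1 => ℂ) 2 →L[ℂ] lp (fun _ : S 1 => ℂ) 2))
    (h₂ : ∀ a, ⟪basisVec 1, π₂ a (basisVec 1)⟫_ℂ = τ₂ a)
    (hd₂ : DenseRange fun a => π₂ a (basisVec 1)) :
    ∃ (K : Type w) (_ : NormedAddCommGroup K) (_ : InnerProductSpace ℂ K) (_ : CompleteSpace K)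
      (N : VonNeumannAlgebra K) (τN : N.toStarSubalgebra →ₗ[ℂ] ℂ)
      (φ : M₁.toStarSubalgebra →⋆ₐ[ℂ] N.toStarSubalgebra)
      (ψ : M₂.toStarSubalgebra →⋆ₐ[ℂ] N.toStarSubalgebra),
      IsTracialFreeProduct M₁ τ₁ M₂ τ₂ N τN φ ψ := by
  let φ' := (freeRep (S := S) 0).comp π₁
  let ψ' := (freeRep (S := S) 1).comp π₂
  have hφ' : ∀ a, vacuumState S (φ' a) = τ₁ a := fun a => (inner_vacuum_freeRep 0 _).trans (h₁ a)
  have hψ' : ∀ a, vacuumState S (ψ' a) = τ₂ a := fun a => (inner_vacuum_freeRep 1 _).trans (h₂ a)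
  let T := Set.range φ' ∪ Set.range ψ'
  let B : Fin 2 → StarSubalgebra ℂ (lp (fun _ : Word S => ℂ) 2 →L[ℂ] lp (fun _ : Word S => ℂ) 2) :=
    ![φ'.range, ψ'.range]
  have hB : ∀ i, B i ≤ (freeRep (S := S) i).range := by
    intro i
    fin_cases i
    · rintro _ ⟨a, rfl⟩; exact ⟨π₁ a, rfl⟩
    · rintro _ ⟨a, rfl⟩; exact ⟨π₂ a, rfl⟩
  -- Freeness holds already for the images of all bounded operators on ℓ²(S i), and so passes to
  -- subalgebras.
  have hfree : ∀ {i x}, AltCentred (vacuumState S) B i x → vacuumState S x = 0 := by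
    intro i x hx
    refine vacuumState_eq_zero_of_altCentred (i := i) ?_
    induction hx with
    | single ha h0 => exact .single (hB _ ha) h0
    | cons ha h0 hij _ ih => exact .cons (hB _ ha) h0 hij ih
  have hBtr : ∀ i, ∀ a ∈ B i, ∀ b ∈ B i, vacuumState S (a * b) = vacuumState S (b * a) := by
    intro i
    fin_cases i
    · rintro _ ⟨a, rfl⟩ _ ⟨b, rfl⟩
      change vacuumState S (φ' a * φ' b) = vacuumState S (φ' b * φ' a)
      rw [← map_mul, ← map_mul, hφ', hφ', htr₁]
    · rintro _ ⟨a, rfl⟩ _ ⟨b, rfl⟩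
      change vacuumState S (ψ' a * ψ' b) = vacuumState S (ψ' b * ψ' a)
      rw [← map_mul, ← map_mul, hψ', hψ', htr₂]
  have hΩ : ‖vacuum S‖ = 1 := norm_basisVec _
  have hone : vacuumState S 1 = 1 := by
    change ⟪vacuum S, vacuum S⟫_ℂ = 1
    rw [inner_self_eq_norm_sq_to_K, hΩ]; simp
  have hT : T ∪ star T = ⋃ i, (B i : Set _) := by
    have hstar : star T ⊆ T := by
      rintro x (⟨a, ha⟩ | ⟨a, ha⟩)
      · exact Or.inl ⟨star a, by rw [map_star, ha, star_star]⟩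
      · exact Or.inr ⟨star a, by rw [map_star, ha, star_star]⟩
    rw [Set.union_eq_self_of_subset_right hstar]
    ext x
    rw [Set.mem_iUnion, Fin.exists_fin_two]
    rfl
  have hadj : ∀ x ∈ StarAlgebra.adjoin ℂ T, x ∈ Algebra.adjoin ℂ (⋃ i, (B i : Set _)) := by
    intro x hx
    rw [← hT, ← StarAlgebra.adjoin_toSubalgebra]
    exact hx
  have hTφ : ∀ a, φ' a ∈ StarAlgebra.adjoin ℂ T :=
    fun a => StarAlgebra.subset_adjoin ℂ T (Or.inl ⟨a, rfl⟩)
  have hTψ : ∀ a, ψ' a ∈ StarAlgebra.adjoin ℂ T :=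
    fun a => StarAlgebra.subset_adjoin ℂ T (Or.inr ⟨a, rfl⟩)
  have hd : DenseRange (evalAt (StarAlgebra.adjoin ℂ T) (vacuum S)) := by
    refine denseRange_evalAt_vacuum fun i => ?_
    fin_cases i
    · refine hd₁.mono ?_
      rintro _ ⟨a, rfl⟩
      exact ⟨π₁ a, hTφ a, rfl⟩
    · refine hd₂.mono ?_
      rintro _ ⟨a, rfl⟩
      exact ⟨π₂ a, hTψ a, rfl⟩
  have htrace := isFaithfulNormalTracialState_vectorFunctional T hΩ hd fun a ha b hb =>
    tracial_of_free hone hfree hBtr (hadj a ha) (hadj b hb)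
  have hsub : StarAlgebra.adjoin ℂ T ≤ (vonNeumannGenerated T).toStarSubalgebra :=
    StarAlgebra.adjoin_le_centralizer_centralizer ℂ T
  let N := vonNeumannGenerated T
  let φ : M₁.toStarSubalgebra →⋆ₐ[ℂ] N.toStarSubalgebra :=
    φ'.codRestrict _ fun a => hsub (hTφ a)
  let ψ : M₂.toStarSubalgebra →⋆ₐ[ℂ] N.toStarSubalgebra :=
    ψ'.codRestrict _ fun a => hsub (hTψ a)
  refine ⟨lp (fun _ : Word S => ℂ) 2, inferInstance, inferInstance, inferInstance, N,
    vectorFunctional N (vacuum S), φ, ψ, htrace, hφ', hψ', ?_, rfl⟩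
  refine areFree_of_mem (σ := vacuumState S) (B := B) (fun _ => rfl) ?_ hfree
  refine Fin.forall_fin_two.2 ⟨?_, ?_⟩
  · rintro x ⟨y, hy⟩
    exact ⟨y, congrArg Subtype.val hy⟩
  · rintro x ⟨y, hy⟩
    exact ⟨y, congrArg Subtype.val hy⟩

/-- The free product of two von Neumann algebras with tracial vector states exists. -/
theorem exists_tracialFreeProduct
    (M₁ : VonNeumannAlgebra H₁) (τ₁ : M₁.toStarSubalgebra →ₗ[ℂ] ℂ)
    (M₂ : VonNeumannAlgebra H₂) (τ₂ : M₂.toStarSubalgebra →ₗ[ℂ] ℂ)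
    (htr₁ : ∀ x y, τ₁ (x * y) = τ₁ (y * x)) (htr₂ : ∀ x y, τ₂ (x * y) = τ₂ (y * x))
    (h₁ : HasCyclicRep.{w} τ₁) (h₂ : HasCyclicRep.{w} τ₂) :
    ∃ (K : Type w) (_ : NormedAddCommGroup K) (_ : InnerProductSpace ℂ K) (_ : CompleteSpace K)
      (N : VonNeumannAlgebra K) (τN : N.toStarSubalgebra →ₗ[ℂ] ℂ)
      (φ : M₁.toStarSubalgebra →⋆ₐ[ℂ] N.toStarSubalgebra)
      (ψ : M₂.toStarSubalgebra →⋆ₐ[ℂ] N.toStarSubalgebra),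
      IsTracialFreeProduct M₁ τ₁ M₂ τ₂ N τN φ ψ := by
  obtain ⟨X₁, i₁, π₁, h₁, hd₁⟩ := h₁
  obtain ⟨X₂, i₂, π₂, h₂, hd₂⟩ := h₂
  let S : Fin 2 → Type w := ![X₁, X₂]
  let : ∀ i, Monoid (S i) := Fin.cons i₁ (Fin.cons i₂ finZeroElim)
  exact exists_tracialFreeProduct_aux (S := S) M₁ τ₁ M₂ τ₂ htr₁ htr₂ π₁ h₁ hd₁ π₂ h₂ hd₂

end Existence

/-! ### Representations of tracial von Neumann algebras and of groups -/

section Representations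

universe v

/-- The GNS representation of a state on a C⋆-algebra. -/
lemma hasCyclicRep_of_state {A : Type v} [CStarAlgebra A] {τ : A →ₗ[ℂ] ℂ} (hone : τ 1 = 1)
    (hpos : ∀ x, 0 ≤ τ (star x * x)) : HasCyclicRep.{max u v} τ := by
  let _ : PartialOrder A := CStarAlgebra.spectralOrder A
  have _ : StarOrderedRing A := CStarAlgebra.spectralOrderedRing A
  let f : A →ₚ[ℂ] ℂ := PositiveLinearMap.mk₀ τ fun x hx => by
    obtain ⟨y, rfl⟩ := CStarAlgebra.nonneg_iff_eq_star_mul_self.1 hx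
    exact hpos y
  let ξ : f.GNS := (f.toPreGNS 1 : f.PreGNS)
  have key : ∀ a, f.gnsStarAlgHom a ξ = (f.toPreGNS a : f.PreGNS) := fun a => by
    change f.gnsNonUnitalStarAlgHom a _ = _
    rw [f.gnsNonUnitalStarAlgHom_apply_coe]
    simp
  refine hasCyclicRep_of_vector.{u} f.gnsStarAlgHom (ξ := ξ) ?_ (fun a => ?_) ?_
  · rw [UniformSpace.Completion.norm_coe, f.preGNS_norm_def]
    change √(τ (star 1 * 1)).re = 1
    simp [hone]
  · rw [key, UniformSpace.Completion.inner_coe, f.preGNS_inner_def]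
    change τ (star 1 * a) = τ a
    simp
  · simp_rw [key]
    exact UniformSpace.Completion.denseRange_coe.comp f.toPreGNS.surjective.denseRange
      (UniformSpace.Completion.continuous_coe _)

variable {H : Type v} [NormedAddCommGroup H] [InnerProductSpace ℂ H] [CompleteSpace H]

/-- Norm closedness makes `M` a C⋆-algebra, which the GNS construction and the square roots of the
defects need. -/
lemma VonNeumannAlgebra.isClosed (M : VonNeumannAlgebra H) :
    IsClosed (M.toStarSubalgebra : Set (H →L[ℂ] H)) := by
  rw [VonNeumannAlgebra.coe_toStarSubalgebra, ← M.centralizer_centralizer]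
  exact Set.isClosed_centralizer _

lemma IsFaithfulNormalTracialState.hasCyclicRep {M : VonNeumannAlgebra H}
    {τ : M.toStarSubalgebra →ₗ[ℂ] ℂ} (hτ : IsFaithfulNormalTracialState M τ) :
    HasCyclicRep.{max u v} τ :=
  have := M.isClosed
  hasCyclicRep_of_state.{u} (A := M.toStarSubalgebra) hτ.map_one hτ.nonneg

variable {Γ : Type v} [Group Γ]

lemma leftRegular_basisVec (g h : Γ) : leftRegular g (basisVec h) = basisVec (g * h) := by
  refine lp.ext (funext fun k => ?_)
  change (basisVec h : Γ → ℂ) (g⁻¹ * k) = _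
  by_cases hk : k = g * h
  · subst hk
    rw [inv_mul_cancel_left, basisVec_apply_self, basisVec_apply_self]
  · rw [basisVec_apply_ne hk, basisVec_apply_ne]
    rwa [Ne, inv_mul_eq_iff_eq_mul]

lemma leftRegular_mul (g h : Γ) : leftRegular (g * h) = leftRegular g * leftRegular h := by
  refine ContinuousLinearMap.ext fun f => lp.ext (funext fun k => ?_)
  change f ((g * h)⁻¹ * k) = f (h⁻¹ * (g⁻¹ * k))
  rw [mul_inv_rev, mul_assoc]

lemma leftRegular_one : leftRegular (1 : Γ) = 1 := by
  refine ContinuousLinearMap.ext fun f => lp.ext (funext fun k => ?_)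
  change f (1⁻¹ * k) = f k
  rw [inv_one, one_mul]

lemma star_leftRegular (g : Γ) : star (leftRegular g) = leftRegular g⁻¹ := by
  refine ((ContinuousLinearMap.eq_adjoint_iff _ _).2 fun f f' => ?_).symm
  rw [lp.inner_eq_tsum, lp.inner_eq_tsum, ← (Equiv.mulLeft g⁻¹).tsum_eq]
  refine tsum_congr fun k => ?_
  change ⟪f (g⁻¹⁻¹ * (g⁻¹ * k)), f' (g⁻¹ * k)⟫_ℂ = ⟪f k, f' (g⁻¹ * k)⟫_ℂ
  simp

/-- The operators λ(g) are closed under products and adjoints. Traciality thus reduces to gh = 1 ↔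
hg = 1. -/
lemma adjoin_leftRegular_le {x : lp (fun _ : Γ => ℂ) 2 →L[ℂ] lp (fun _ : Γ => ℂ) 2}
    (hx : x ∈ StarAlgebra.adjoin ℂ (Set.range (leftRegular (Γ := Γ)))) :
    x ∈ Submodule.span ℂ (Set.range (leftRegular (Γ := Γ))) := by
  have h1 : Set.range (leftRegular (Γ := Γ)) ∪ star (Set.range (leftRegular (Γ := Γ))) =
      Set.range (leftRegular (Γ := Γ)) := by
    refine Set.union_eq_self_of_subset_right ?_
    rintro y ⟨g, hg⟩
    exact ⟨g⁻¹, by rw [← star_leftRegular, hg, star_star]⟩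
  have h2 : x ∈ Algebra.adjoin ℂ (Set.range (leftRegular (Γ := Γ))) := by
    rw [← h1, ← StarAlgebra.adjoin_toSubalgebra]; exact hx
  rw [← Subalgebra.mem_toSubmodule, Algebra.adjoin_eq_span] at h2
  have h3 : (Submonoid.closure (Set.range (leftRegular (Γ := Γ))) : Set _) ⊆
      Set.range (leftRegular (Γ := Γ)) := by
    let f : Γ →* (lp (fun _ : Γ => ℂ) 2 →L[ℂ] lp (fun _ : Γ => ℂ) 2) :=
      ⟨⟨leftRegular, leftRegular_one⟩, leftRegular_mul⟩
    exact (Submonoid.closure_le (S := MonoidHom.mrange f)).2 (fun _ h => h)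
  exact Submodule.span_mono h3 h2

lemma groupTrace_eq_vectorFunctional :
    groupTrace Γ = vectorFunctional (groupVonNeumann Γ) (basisVec 1) := rfl

lemma denseRange_evalAt_leftRegular :
    DenseRange (evalAt (StarAlgebra.adjoin ℂ (Set.range (leftRegular (Γ := Γ)))) (basisVec 1)) := by
  intro f
  refine (Submodule.isClosed_topologicalClosure (LinearMap.range (evalAt (StarAlgebra.adjoin ℂ
    (Set.range (leftRegular (Γ := Γ)))) (basisVec 1)))).mem_of_tendsto (hasSum_basisVec f)
    (Filter.Eventually.of_forall fun F => Submodule.le_topologicalClosure _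
      (Submodule.sum_mem _ fun g _ => Submodule.smul_mem _ _ ?_))
  refine ⟨⟨leftRegular g, StarAlgebra.subset_adjoin ℂ _ ⟨g, rfl⟩⟩, ?_⟩
  change leftRegular g (basisVec 1) = _
  rw [leftRegular_basisVec, mul_one]

/-- The canonical trace of a group von Neumann algebra is a faithful normal tracial state. -/
theorem isFaithfulNormalTracialState_groupTrace :
    IsFaithfulNormalTracialState (groupVonNeumann Γ) (groupTrace Γ) := by
  rw [groupTrace_eq_vectorFunctional]
  refine isFaithfulNormalTracialState_vectorFunctional _ (norm_basisVec _)
    denseRange_evalAt_leftRegular fun a ha b hb => ?_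
  replace ha := adjoin_leftRegular_le ha
  replace hb := adjoin_leftRegular_le hb
  induction ha using Submodule.span_induction with
  | zero => simp
  | add x y _ _ hx hy => rw [add_mul, mul_add]; simp only [add_apply, inner_add_right, hx, hy]
  | smul c x _ hx => rw [smul_mul_assoc, mul_smul_comm]; simp only [smul_apply, inner_smul_right, hx]
  | mem x hx =>
    obtain ⟨g, rfl⟩ := hx
    induction hb using Submodule.span_induction with
    | zero => simp
    | add x y _ _ hx hy => rw [add_mul, mul_add]; simp only [add_apply, inner_add_right, hx, hy]
    | smul c x _ hx => rw [smul_mul_assoc, mul_smul_comm]; simp only [smul_apply, inner_smul_right, hx]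
    | mem x hx =>
      obtain ⟨h, rfl⟩ := hx
      rw [← leftRegular_mul, ← leftRegular_mul, leftRegular_basisVec, leftRegular_basisVec,
        inner_basisVec_left, inner_basisVec_left, mul_one, mul_one]
      by_cases hgh : g * h = 1
      · rw [hgh, mul_eq_one_comm.1 hgh]
      · rw [basisVec_apply_ne (Ne.symm hgh), basisVec_apply_ne]
        exact fun h' => hgh (mul_eq_one_comm.1 h'.symm)

/-- The unitaries of the group von Neumann algebra given by the group elements. -/
noncomputable def groupUnitary (Γ : Type v) [Group Γ] : Γ →* (groupVonNeumann Γ).toStarSubalgebra where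
  toFun g := ⟨leftRegular g, StarAlgebra.adjoin_le_centralizer_centralizer ℂ _
    (StarAlgebra.subset_adjoin ℂ _ ⟨g, rfl⟩)⟩
  map_one' := Subtype.ext leftRegular_one
  map_mul' g h := Subtype.ext (leftRegular_mul g h)

lemma star_groupUnitary (g : Γ) : star (groupUnitary Γ g) = groupUnitary Γ g⁻¹ :=
  Subtype.ext (star_leftRegular g)

lemma groupTrace_groupUnitary {g : Γ} (hg : g ≠ 1) : groupTrace Γ (groupUnitary Γ g) = 0 := by
  change ⟪basisVec 1, leftRegular g (basisVec 1)⟫_ℂ = 0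
  rw [leftRegular_basisVec, inner_basisVec_left, mul_one, basisVec_apply_ne (Ne.symm hg)]

end Representations

/-! ### Defect operators of a contraction -/

section Defect

variable {A : Type*} [CStarAlgebra A]

/-- Nonnegative square roots of intertwined elements are intertwined. -/
lemma intertwine_of_sq [PartialOrder A] [StarOrderedRing A] {x s t : A} (hs : 0 ≤ s) (ht : 0 ≤ t)
    (h : x * (s * s) = t * t * x) : x * s = t * x := by
  -- The hypothesis gives td = -ds. Hence d*ds = -d*td is nonpositive; being self-adjoint, it is
  -- also a product of commuting nonnegative elements, so it vanishes.
  set d := x * s - t * x with hd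
  have h1 : t * d = -(d * s) := by
    rw [hd, mul_sub, sub_mul, mul_assoc x, h]
    noncomm_ring
  have hP : 0 ≤ star d * d := star_mul_self_nonneg d
  have hQ : 0 ≤ star d * t * d := star_left_conjugate_nonneg ht d
  have hPQ : star d * d * s = -(star d * t * d) := by
    rw [mul_assoc (star d) t, h1, mul_neg, neg_neg, mul_assoc]
  have hcomm : Commute (star d * d) s := by
    have h2 := congrArg star hPQ
    rw [star_mul, star_neg, hP.isSelfAdjoint.star_eq, hs.isSelfAdjoint.star_eq,
      hQ.isSelfAdjoint.star_eq, ← hPQ] at h2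
    exact h2.symm
  have hPs : star d * d * s = 0 := by
    refine le_antisymm ?_ (hcomm.mul_nonneg hP hs)
    rw [hPQ]
    exact neg_nonpos.2 hQ
  have hds : d * s = 0 := by
    rw [← CStarRing.star_mul_self_eq_zero_iff, star_mul, hs.isSelfAdjoint.star_eq]
    rw [mul_assoc, ← mul_assoc (star d), hPs, mul_zero]
  have htd : t * d = 0 := by rw [h1, hds, neg_zero]
  have hdt : star d * t = 0 := by
    have := congrArg star htd
    rwa [star_mul, ht.isSelfAdjoint.star_eq, star_zero] at this
  have hsd : s * star d = 0 := by
    have := congrArg star hds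
    rwa [star_mul, hs.isSelfAdjoint.star_eq, star_zero] at this
  -- Expanding the second d and using d*t = 0 leaves d*xs; since sd* = 0, this gives d*dd* = 0.
  have hdd : star d * d = star d * x * s := by
    conv_lhs => rw [hd, mul_sub, ← mul_assoc, ← mul_assoc, ← hd, hdt, zero_mul, sub_zero]
  have hddd : star d * d * star d = 0 := by
    rw [hdd, mul_assoc, hsd, mul_zero]
  have hz : (star d * d) * (star d * d) = 0 := by rw [← mul_assoc, hddd, zero_mul]
  have hz' : star d * d = 0 := by
    rw [← CStarRing.star_mul_self_eq_zero_iff, hP.isSelfAdjoint.star_eq, hz]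
  exact sub_eq_zero.1 (CStarRing.star_mul_self_eq_zero_iff d |>.1 hz')

/-- The defect operators `(1 - x* x)^{1/2}` and `(1 - x x*)^{1/2}` of a contraction. -/
theorem exists_defect (x : A) (hx : ‖x‖ ≤ 1) :
    ∃ s t : A, star s = s ∧ star t = t ∧ s * s = 1 - star x * x ∧ t * t = 1 - x * star x ∧
      x * s = t * x := by
  let _ : PartialOrder A := CStarAlgebra.spectralOrder A
  have _ : StarOrderedRing A := CStarAlgebra.spectralOrderedRing A
  have key : ∀ y : A, ‖y‖ ≤ 1 → 0 ≤ 1 - star y * y := fun y hy => by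
    refine sub_nonneg.2 ((CStarAlgebra.norm_le_one_iff_of_nonneg _ (star_mul_self_nonneg y)).1 ?_)
    rw [CStarRing.norm_star_mul_self]
    exact mul_le_one₀ hy (norm_nonneg _) hy
  have h1 := key x hx
  have h2 := key (star x) (by rwa [norm_star])
  rw [star_star] at h2
  refine ⟨CFC.sqrt (1 - star x * x), CFC.sqrt (1 - x * star x),
    (CFC.sqrt_nonneg _).isSelfAdjoint, (CFC.sqrt_nonneg _).isSelfAdjoint,
    CFC.sqrt_mul_sqrt_self _ h1, CFC.sqrt_mul_sqrt_self _ h2, ?_⟩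
  refine intertwine_of_sq (CFC.sqrt_nonneg _) (CFC.sqrt_nonneg _) ?_
  rw [CFC.sqrt_mul_sqrt_self _ h1, CFC.sqrt_mul_sqrt_self _ h2]
  noncomm_ring

end Defect

/-! ### Reduced products with a free group -/

section FreeGroupProducts

variable {M N Y : Type*} [Ring M] [Algebra ℂ M] [Ring N] [Algebra ℂ N]

/-- `ReducedProd τ φ v g x` means that `x = v g₁ * φ a₁ * ⋯ * v gᵣ * φ aᵣ`, where `g₁ = g`, the
`gₖ` are nontrivial, and `a₁, …, aᵣ₋₁` have trace zero. -/
inductive ReducedProd (τ : M →ₗ[ℂ] ℂ) (φ : M →ₐ[ℂ] N) (v : FreeGroup Y →* N) :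
    FreeGroup Y → N → Prop
  | base {g : FreeGroup Y} (hg : g ≠ 1) (a : M) : ReducedProd τ φ v g (v g * φ a)
  | step {g h : FreeGroup Y} {a : M} {x : N} (hg : g ≠ 1) (ha : τ a = 0)
      (hx : ReducedProd τ φ v h x) : ReducedProd τ φ v g (v g * (φ a * x))

variable {τ : M →ₗ[ℂ] ℂ} {φ : M →ₐ[ℂ] N} {v : FreeGroup Y →* N}

open Classical in
/-- The span of the reduced products such that the first letter of the reduced word of the first
group element is `(y, ε)`. -/
def reducedSpan (τ : M →ₗ[ℂ] ℂ) (φ : M →ₐ[ℂ] N) (v : FreeGroup Y →* N) (y : Y) (ε : Bool) :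
    Submodule ℂ N :=
  Submodule.span ℂ {x | ∃ g : FreeGroup Y, g.toWord.head? = some (y, ε) ∧ ReducedProd τ φ v g x}

/-- A generator of the free group or its inverse. -/
def freeLetter (y : Y) (ε : Bool) : FreeGroup Y := FreeGroup.mk [(y, ε)]

lemma freeLetter_inv (y : Y) (ε : Bool) : (freeLetter y ε)⁻¹ = freeLetter y (!ε) := rfl

open Classical in
lemma toWord_freeLetter (y : Y) (ε : Bool) : (freeLetter y ε).toWord = [(y, ε)] := by
  simp [freeLetter]

open Classical in
lemma head_toWord_freeLetter_mul {y y' : Y} {ε ε' : Bool} {g : FreeGroup Y}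
    (hg : g.toWord.head? = some (y', ε')) (h : ¬ (y' = y ∧ ε' = !ε)) :
    (freeLetter y ε * g).toWord.head? = some (y, ε) := by
  obtain ⟨l, hl⟩ : ∃ l, g.toWord = (y', ε') :: l := by
    cases hw : g.toWord with
    | nil => rw [hw] at hg; cases hg
    | cons a l => rw [hw] at hg; cases hg; exact ⟨l, rfl⟩
  have hred : FreeGroup.IsReduced ((y, ε) :: (y', ε') :: l) := by
    rw [FreeGroup.isReduced_cons_cons, ← hl]
    refine ⟨fun hy => ?_, FreeGroup.isReduced_toWord⟩
    by_contra hε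
    exact h ⟨hy.symm, by revert hε; cases ε <;> cases ε' <;> simp⟩
  rw [FreeGroup.toWord_mul, toWord_freeLetter, hl, List.singleton_append, hred.reduce_eq]
  rfl

open Classical in
lemma ne_one_of_head_toWord {g : FreeGroup Y} {p : Y × Bool} (hg : g.toWord.head? = some p) :
    g ≠ 1 := by
  rintro rfl
  simp at hg

lemma freeLetter_mul_mem_reducedSpan (y : Y) (ε : Bool) (a : M) :
    v (freeLetter y ε) * φ a ∈ reducedSpan τ φ v y ε := by
  classical
  have h : (freeLetter y ε).toWord.head? = some (y, ε) := by rw [toWord_freeLetter]; rfl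
  exact Submodule.subset_span ⟨_, by convert h, .base (ne_one_of_head_toWord h) a⟩

/-- Split `m` into a centred part and a scalar. The centred part separates the group elements; the
scalar part multiplies the new letter into the first group element, and the excluded case is exactly
the one where that letter cancels. -/
lemma freeLetter_mul_mul_mem_reducedSpan (hτ : τ 1 = 1) {y y' : Y} {ε ε' : Bool} {m : M} {x : N}
    (hx : x ∈ reducedSpan τ φ v y' ε') (h : τ m = 0 ∨ ¬ (y' = y ∧ ε' = !ε)) :
    v (freeLetter y ε) * (φ m * x) ∈ reducedSpan τ φ v y ε := by
  classical
  have hl : (freeLetter y ε).toWord.head? = some (y, ε) := by rw [toWord_freeLetter]; rfl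
  refine Submodule.span_induction ?_ ?_ ?_ ?_ hx
  · rintro x ⟨g, hg, hx⟩
    have hcent : ∀ a, τ a = 0 → v (freeLetter y ε) * (φ a * x) ∈ reducedSpan τ φ v y ε :=
      fun a ha => Submodule.subset_span ⟨_, by convert hl, .step (ne_one_of_head_toWord hl) ha hx⟩
    rcases h with h | h
    · exact hcent m h
    · have hscal : v (freeLetter y ε) * x ∈ reducedSpan τ φ v y ε := by
        have hg' := head_toWord_freeLetter_mul (ε := ε) (y := y) (g := g) (by convert hg) h
        refine Submodule.subset_span ⟨freeLetter y ε * g, by convert hg', ?_⟩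
        cases hx with
        | base _ a =>
          rw [← mul_assoc, ← map_mul]
          exact .base (ne_one_of_head_toWord hg') a
        | step _ ha hx =>
          rw [← mul_assoc, ← map_mul]
          exact .step (ne_one_of_head_toWord hg') ha hx
      have e : φ m = φ (m - τ m • 1) + τ m • 1 := by simp
      rw [e, add_mul, smul_one_mul, mul_add, mul_smul_comm]
      exact add_mem (hcent _ (by simp [hτ])) (Submodule.smul_mem _ _ hscal)
  · simp
  · intro x z _ _ hx hz
    rw [mul_add, mul_add]; exact add_mem hx hz
  · intro c x _ hx
    rw [mul_smul_comm, mul_smul_comm]; exact Submodule.smul_mem _ _ hx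

end FreeGroupProducts

section FreeGroupTrace

variable {M N Y : Type*} [Ring M] [Algebra ℂ M] [Ring N] [Algebra ℂ N] [StarRing N] [StarModule ℂ N]
  {τ : M →ₗ[ℂ] ℂ} {τN : N →ₗ[ℂ] ℂ} {φ : M →ₐ[ℂ] N} {v : FreeGroup Y →* N}
  {B : Fin 2 → StarSubalgebra ℂ N}

/-- A reduced product is an alternating product times an element of `φ(M)`. -/
lemma ReducedProd.exists_altCentred (hφ : ∀ a, φ a ∈ B 0) (hv : ∀ g, v g ∈ B 1)
    (hτφ : ∀ a, τN (φ a) = τ a) (hτv : ∀ g ≠ 1, τN (v g) = 0) {g : FreeGroup Y} {x : N}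
    (hx : ReducedProd τ φ v g x) : ∃ z a, AltCentred τN B 1 z ∧ x = z * φ a := by
  induction hx with
  | @base g hg a => exact ⟨_, a, .single (hv g) (hτv g hg), rfl⟩
  | @step g h a x hg ha hx ih =>
    obtain ⟨z, b, hz, rfl⟩ := ih
    refine ⟨v g * (φ a * z), b, .cons (hv g) (hτv g hg) one_ne_zero
      (.cons (hφ a) ((hτφ a).trans ha) zero_ne_one hz), ?_⟩
    rw [mul_assoc, mul_assoc]

/-- Reduced products have trace zero if the algebras generated by `φ(M)` and the free group are
free. -/
lemma trace_mul_reducedSpan (hτ : τ 1 = 1) (htr : ∀ x y, τN (x * y) = τN (y * x))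
    (hfree : AreFree τN B) (hφ : ∀ a, φ a ∈ B 0) (hv : ∀ g, v g ∈ B 1)
    (hτφ : ∀ a, τN (φ a) = τ a) (hτv : ∀ g ≠ 1, τN (v g) = 0) {y : Y} {ε : Bool} {x : N}
    (hx : x ∈ reducedSpan τ φ v y ε) (m : M) : τN (φ m * x) = 0 := by
  refine Submodule.span_induction ?_ ?_ ?_ ?_ hx
  · rintro x ⟨g, -, hx⟩
    obtain ⟨z, a, hz, rfl⟩ := hx.exists_altCentred hφ hv hτφ hτv
    -- Traciality brings the uncentred last factor φ(a) to the front, where it joins φ(m); splitting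
    -- φ(am) leaves alternating products.
    rw [← mul_assoc, htr, ← mul_assoc, ← map_mul]
    generalize a * m = b
    have hb : τN (φ (b - τ b • 1)) = 0 := by
      rw [hτφ, map_sub, map_smul, hτ, smul_eq_mul, mul_one, sub_self]
    have h1 : τN (φ (b - τ b • 1) * z) = 0 :=
      hfree.apply_eq_zero (AltCentred.cons (hφ _) hb zero_ne_one hz)
    have h2 : τN z = 0 := hfree.apply_eq_zero hz
    simpa [sub_mul, h2] using h1
  · simp
  · intro x z _ _ hx hz
    rw [mul_add, map_add, hx, hz, add_zero]
  · intro c x _ hx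
    rw [mul_smul_comm, map_smul, hx, smul_zero]

end FreeGroupTrace

/-! ### Alternating products -/

section AltProd

/-- The product `f i₁ ε * f i₂ (!ε) * f i₃ ε * ⋯` with alternating signs. -/
def altProd {ι A : Type*} [Monoid A] (f : ι → Bool → A) : Bool → List ι → A
  | _, [] => 1
  | ε, i :: l => f i ε * altProd f (!ε) l

/-- The sign of the last factor of `altProd f ε l` (and `!ε` if `l = []`). -/
def lastSign {ι : Type*} : Bool → List ι → Bool
  | ε, [] => !ε
  | ε, _ :: l => lastSign (!ε) l

variable {ι A : Type*}

lemma altProd_cons [Monoid A] (f : ι → Bool → A) (ε : Bool) (i : ι) (l : List ι) :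
    altProd f ε (i :: l) = f i ε * altProd f (!ε) l := rfl

lemma altProd_concat [Monoid A] (f : ι → Bool → A) (ε : Bool) (l : List ι) (i : ι) :
    altProd f ε (l ++ [i]) = altProd f ε l * f i (!(lastSign ε l)) := by
  induction l generalizing ε with
  | nil => simp [altProd, lastSign]
  | cons j l ih => simp [altProd, lastSign, ih, mul_assoc]

lemma lastSign_eq_not_iff (ε : Bool) (l : List ι) : lastSign ε l = (!ε) ↔ Even l.length := by
  induction l generalizing ε with
  | nil => simp [lastSign]
  | cons j l ih =>
    rw [lastSign, List.length_cons, Nat.even_add_one, ← ih (!ε)]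
    cases lastSign (!ε) l <;> cases ε <;> simp

end AltProd

/-! ### Dilation matrices -/

section Dilation

variable {ι A : Type*} [DecidableEq ι] [Ring A]

/-- The matrix with entries `X i ε`, `R i (!ε)`, `R i ε`, `-X i (!ε)` in the rows and columns
`none`, `some i`, and with the diagonal entries `u i j ε` for `j ≠ i`. -/
def dilation (X R : ι → Bool → A) (u : ι → ι → Bool → A) (i : ι) (ε : Bool) :
    Matrix (Option ι) (Option ι) A
  | none, none => X i ε
  | none, some b => if b = i then R i (!ε) else 0
  | some a, none => if a = i then R i ε else 0
  | some a, some b => if a = b then (if a = i then -X i (!ε) else u i a ε) else 0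

variable {X R : ι → Bool → A} {u : ι → ι → Bool → A}

lemma star_dilation [StarRing A] (hX : ∀ i ε, star (X i ε) = X i (!ε))
    (hR : ∀ i ε, star (R i ε) = R i ε) (hu : ∀ i j ε, i ≠ j → star (u i j ε) = u i j (!ε)) (i : ι)
    (ε : Bool) : star (dilation X R u i ε) = dilation X R u i (!ε) := by
  ext a b
  rw [Matrix.star_apply]
  rcases a with _ | a <;> rcases b with _ | b
  · exact hX i ε
  · simp only [dilation]; split_ifs <;> simp [hR]
  · simp only [dilation]; split_ifs <;> simp [hR]
  · by_cases hab : a = b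
    · subst hab
      by_cases hai : a = i
      · simp [dilation, hai, hX]
      · simp [dilation, hai, hu i a ε (Ne.symm hai)]
    · simp [dilation, hab, Ne.symm hab]

variable [Fintype ι] (B : Matrix (Option ι) (Option ι) A) (i : ι) (ε : Bool) (b : Option ι)

lemma dilation_mul_none : (dilation X R u i ε * B) none b =
    X i ε * B none b + R i (!ε) * B (some i) b := by
  simp [Matrix.mul_apply, Fintype.sum_option, dilation]

lemma dilation_mul_some_self : (dilation X R u i ε * B) (some i) b =
    R i ε * B none b - X i (!ε) * B (some i) b := by
  simp [Matrix.mul_apply, Fintype.sum_option, dilation, sub_eq_add_neg]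

lemma dilation_mul_some_ne {a : ι} (h : a ≠ i) : (dilation X R u i ε * B) (some a) b =
    u i a ε * B (some a) b := by
  simp [Matrix.mul_apply, Fintype.sum_option, dilation, h]

/-- `hR` settles the diagonal of the 2 × 2 Halmos block, and the intertwining relation `hXR` cancels
its off-diagonal entries. -/
lemma dilation_mul_dilation (hR : ∀ i ε, R i ε * R i ε = 1 - X i (!ε) * X i ε)
    (hXR : ∀ i ε, X i ε * R i ε = R i (!ε) * X i ε)
    (hu : ∀ i j ε, i ≠ j → u i j ε * u i j (!ε) = 1) :
    dilation X R u i ε * dilation X R u i (!ε) = 1 := by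
  have h1 := hR i ε
  have h2 := hR i (!ε)
  have h3 := hXR i ε
  have h4 := hXR i (!ε)
  rw [Bool.not_not] at h2 h4
  ext a b
  rcases a with _ | a
  · rw [dilation_mul_none]
    rcases b with _ | b
    · simp [dilation, h2]
    · by_cases hb : b = i
      · subst hb; simp [dilation, h3]
      · simp [dilation, hb, Ne.symm hb]
  · by_cases ha : a = i
    · subst ha
      rw [dilation_mul_some_self]
      rcases b with _ | b
      · simp [dilation, h4]
      · by_cases hb : b = a
        · subst hb; simp [dilation, h1]
        · simp [dilation, hb, Ne.symm hb]
    · rw [dilation_mul_some_ne _ _ _ _ ha]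
      rcases b with _ | b
      · simp [dilation, ha]
      · by_cases hb : a = b
        · subst hb; simp [dilation, ha, hu i a ε (Ne.symm ha)]
        · simp [dilation, hb]

end Dilation

/-! ### The entries of alternating products of dilation matrices -/

section Entries

variable {ι M : Type*} [DecidableEq ι] [Fintype ι] [Ring M] [Algebra ℂ M]
  (ρ : ι → ι → Prop)

/-- `ExitWord ρ X R i ε j δ m`: `m` is an alternating product of elements `X _ _`, beginning with
index `i` and sign `ε`, followed by the factor `R j (!δ)` in a position of sign `δ`, where
consecutive indices satisfy `ρ`. -/
inductive ExitWord (X R : ι → Bool → M) : ι → Bool → ι → Bool → M → Prop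
  | exit (j : ι) (δ : Bool) : ExitWord X R j δ j δ (R j (!δ))
  | step {i i' j : ι} {ε δ : Bool} {m : M} (h : ρ i i') (hm : ExitWord X R i' (!ε) j δ m) :
      ExitWord X R i ε j δ (X i ε * m)

variable {ρ} {X R : ι → Bool → M} {τ : M →ₗ[ℂ] ℂ}

omit [DecidableEq ι] [Fintype ι] [Algebra ℂ M] in
lemma ExitWord.exists_list {i j : ι} {ε δ : Bool} {m : M} (h : ExitWord ρ X R i ε j δ m) :
    ∃ l : List ι, m = altProd X ε l * R j (!δ) ∧ (l ++ [j]).IsChain ρ ∧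
      (l ++ [j]).head? = some i ∧ lastSign ε l = !δ := by
  induction h with
  | exit j δ => exact ⟨[], by simp [altProd, lastSign]⟩
  | @step i i' j ε δ m h hm ih =>
    obtain ⟨l, rfl, h1, h2, h3⟩ := ih
    refine ⟨i :: l, by simp [altProd, mul_assoc], ?_, rfl, by simpa [lastSign] using h3⟩
    rw [List.cons_append, List.isChain_cons]
    refine ⟨fun y hy => ?_, h1⟩
    rw [h2] at hy
    cases hy
    exact h

omit [DecidableEq ι] [Fintype ι] in
/-- The trace of an alternating product which leaves and reenters the row `some i`. -/
lemma trace_defect_mul_exitWord (hρ : ∀ i j, ρ i j → i ≠ j) (htr : ∀ x y, τ (x * y) = τ (y * x))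
    (hR : ∀ i ε, R i ε * R i ε = 1 - X i (!ε) * X i ε)
    (hX : ∀ ε (l : List ι), l ≠ [] → l.IsChain ρ → Even l.length → τ (altProd X ε l) = 0)
    {i i' : ι} {ε : Bool} {m : M} (hi : ρ i i') (hm : ExitWord ρ X R i' (!ε) i (!ε) m) :
    τ (R i ε * m) = 0 := by
  obtain ⟨l, rfl, h1, h2, h3⟩ := hm.exists_list
  rw [Bool.not_not] at h3 ⊢
  -- An empty `l` would mean leaving at once towards i' = i, which `hi` excludes.
  have hl : l ≠ [] := by
    rintro rfl
    simp only [List.nil_append, List.head?_cons, Option.some.injEq] at h2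
    exact hρ _ _ hi h2
  have heven : Even l.length := by
    rw [← lastSign_eq_not_iff (!ε), h3, Bool.not_not]
  have e1 : τ (altProd X (!ε) l) = 0 := hX _ l hl (h1.left_of_append) heven
  have e2 : τ (X i ε * (altProd X (!ε) l * X i (!ε))) = 0 := by
    have h := hX ε (i :: (l ++ [i])) (by simp) (List.isChain_cons.2 ⟨fun y hy => by
      rw [h2] at hy; cases hy; exact hi, h1⟩) (by
      simp only [List.length_cons, List.length_append, List.length_nil]
      obtain ⟨k, hk⟩ := heven
      exact ⟨k + 1, by lia⟩)
    rwa [altProd, altProd_concat, h3] at h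
  -- With w the alternating product over `l`, τ(RwR) = τ(R²w) = τ(w) - τ(X i ε · w · X i (!ε)), and
  -- both terms are covered by L-freeness.
  rw [← mul_assoc, htr, ← mul_assoc, hR, sub_mul, one_mul, map_sub, e1, mul_assoc, htr, mul_assoc,
    e2, sub_zero]

-- Putting `u = 0` keeps only the paths that meet no free unitary, and a row outside `none`, `some
-- i` of the first matrix offers nothing else.
omit [Algebra ℂ M] in
lemma altProd_dilation_some_ne (ε : Bool) {i a : ι} (l : List ι)
    (h : a ≠ i) (b : Option ι) : altProd (dilation X R 0) ε (i :: l) (some a) b = 0 := by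
  rw [altProd, dilation_mul_some_ne _ _ _ _ h]
  simp

omit [Algebra ℂ M] in
lemma altProd_dilation_none_none (hρ : ∀ i j, ρ i j → i ≠ j) (ε : Bool) (l : List ι)
    (hl : l.IsChain ρ) : altProd (dilation X R 0) ε l none none = altProd X ε l := by
  induction l generalizing ε with
  | nil => simp [altProd]
  | cons i l ih =>
    rw [altProd, altProd, dilation_mul_none, ih _ hl.tail]
    cases l with
    | nil => simp [altProd]
    | cons i' l =>
      rw [altProd_dilation_some_ne _ _ (hρ _ _ (List.isChain_cons_cons.1 hl).1)]
      simp

-- Without free unitaries, a path from `none` can leave only at the last factor: in the row it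
-- reaches, the next matrix, having another index, has only zeros.
omit [Algebra ℂ M] in
lemma altProd_dilation_none_some (hρ : ∀ i j, ρ i j → i ≠ j) (ε : Bool) (i : ι) (l : List ι)
    (hl : (i :: l).IsChain ρ) (j : ι) :
    altProd (dilation X R 0) ε (i :: l) none (some j) = 0 ∨
      ExitWord ρ X R i ε j (lastSign ε (i :: l))
        (altProd (dilation X R 0) ε (i :: l) none (some j)) := by
  induction l generalizing i ε with
  | nil =>
    by_cases hij : j = i
    · subst hij
      right
      simpa [altProd, lastSign, dilation] using ExitWord.exit (ρ := ρ) (X := X) (R := R) j ε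
    · left
      simp [altProd, dilation, hij]
  | cons i' l ih =>
    have hii' := (List.isChain_cons_cons.1 hl).1
    rw [altProd, dilation_mul_none, altProd_dilation_some_ne _ _ (hρ _ _ hii'), mul_zero,
      add_zero]
    rcases ih (!ε) i' hl.tail with h | h
    · left; rw [h, mul_zero]
    · right; exact .step hii' h

variable {N : Type*} [Ring N] [Algebra ℂ N] {φ : M →ₐ[ℂ] N} {u : ι → ι → Bool → N}
  {W : ι → ι → Bool → Submodule ℂ N}

/-- Sums of products of elements of `M` and reduced words which can be continued reducedly after an
entry in the row `some i` of a dilation matrix with index `i` and sign `ε`. -/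
def stayingSpan (τ : M →ₗ[ℂ] ℂ) (φ : M →ₐ[ℂ] N) (W : ι → ι → Bool → Submodule ℂ N) (i : ι)
    (ε : Bool) : Submodule ℂ N :=
  Submodule.span ℂ {y | ∃ m k j δ x, k ≠ j ∧ x ∈ W k j δ ∧ (τ m = 0 ∨ ¬ (j = i ∧ δ = ε)) ∧
    y = φ m * x}

/-- Sums of products of exit words and reduced words. -/
def exitingSpan (ρ : ι → ι → Prop) (X R : ι → Bool → M) (φ : M →ₐ[ℂ] N)
    (W : ι → ι → Bool → Submodule ℂ N) (i : ι) (ε : Bool) : Submodule ℂ N :=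
  Submodule.span ℂ {y | ∃ m k j δ x, k ≠ j ∧ x ∈ W k j (!δ) ∧ ExitWord ρ X R i ε j δ m ∧
    y = φ m * x}

omit [DecidableEq ι] [Fintype ι] [Algebra ℂ M] in
lemma mul_mem_of_span {M' : Type*} [Ring M'] [Algebra ℂ M'] {s : Set M'} {t : Submodule ℂ M'}
    {c x : M'} (hs : ∀ y ∈ s, c * y ∈ t) (hx : x ∈ Submodule.span ℂ s) : c * x ∈ t :=
  (Submodule.span_le (p := t.comap (LinearMap.mulLeft ℂ c))).2 hs hx

/-- The entries of an alternating product of dilation matrices, up to the part coming from `M`. -/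
theorem altProd_dilation_entries (hρ : ∀ i j, ρ i j → i ≠ j)
    (hRX : ∀ {i i' ε m}, ρ i i' → ExitWord ρ X R i' (!ε) i (!ε) m → τ (R i ε * m) = 0)
    (hW : ∀ {i j ε}, i ≠ j → ∀ a, u i j ε * φ a ∈ W i j ε)
    (hW' : ∀ {i j ε i' j' ε' m x}, i ≠ j → i' ≠ j' → x ∈ W i' j' ε' →
      (τ m = 0 ∨ ¬ (i' = i ∧ j' = j ∧ ε' = !ε)) → u i j ε * (φ m * x) ∈ W i j ε)
    (ε : Bool) (i : ι) (l : List ι) (hl : (i :: l).IsChain ρ) (b : Option ι) :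
    let D := dilation (fun i ε => φ (X i ε)) (fun i ε => φ (R i ε)) u
    let Z := dilation X R 0
    (∀ a, a ≠ i → altProd D ε (i :: l) (some a) b ∈ W i a ε) ∧
    altProd D ε (i :: l) (some i) b - φ (altProd Z ε (i :: l) (some i) b) ∈ stayingSpan τ φ W i ε ∧
    altProd D ε (i :: l) none b - φ (altProd Z ε (i :: l) none b) ∈ exitingSpan ρ X R φ W i ε := by
  intro D Z
  induction l generalizing i ε with
  | nil =>
    simp only [altProd, mul_one]
    refine ⟨fun a ha => ?_, ?_, ?_⟩
    · rcases b with _ | b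
      · simp [D, dilation, ha]
      · by_cases hab : a = b
        · subst hab
          simpa [D, dilation, ha] using hW (ε := ε) (Ne.symm ha) 1
        · simp [D, dilation, hab]
    · convert zero_mem (stayingSpan τ φ W i ε)
      rcases b with _ | b
      · simp [D, Z, dilation]
      · by_cases hb : i = b
        · subst hb; simp [D, Z, dilation]
        · simp [D, Z, dilation, hb]
    · convert zero_mem (exitingSpan ρ X R φ W i ε)
      rcases b with _ | b
      · simp [D, Z, dilation]
      · by_cases hb : b = i
        · subst hb; simp [D, Z, dilation]
        · simp [D, Z, dilation, hb]
  | cons i' l ih =>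
    obtain ⟨hii', hl'⟩ := List.isChain_cons_cons.1 hl
    have hne := hρ _ _ hii'
    obtain ⟨ih1, ih2, ih3⟩ := ih (!ε) i' hl'
    have hi := ih1 i hne
    have hZ := altProd_dilation_some_ne (X := X) (R := R) (!ε) l hne b
    refine ⟨fun a ha => ?_, ?_, ?_⟩
    · rw [altProd, dilation_mul_some_ne _ _ _ _ ha]
      -- If a = i', the tail stays in or leaves its own Halmos row, and the condition in
      -- `stayingSpan` is exactly what forbids cancellation with `u i a ε`. Otherwise the next
      -- letter belongs to another generator, as i ≠ i'.
      by_cases hai : a = i'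
      · subst hai
        rw [← sub_add_cancel (altProd D (!ε) (a :: l) (some a) b)
          (φ (altProd Z (!ε) (a :: l) (some a) b)), mul_add]
        refine add_mem (mul_mem_of_span ?_ ih2) (hW hne _)
        rintro _ ⟨m, k, j, δ, x, hkj, hx, hm, rfl⟩
        refine hW' hne hkj hx (hm.imp_right fun h => ?_)
        rintro ⟨-, h1, h2⟩
        exact h ⟨h1, h2⟩
      · have := hW' (m := 1) (ε := ε) (Ne.symm ha) (Ne.symm hai) (ih1 a hai)
          (Or.inr fun h => hne h.1.symm)
        simpa using this
    · rw [altProd_cons D, altProd_cons Z, dilation_mul_some_self, dilation_mul_some_self, hZ, mul_zero, sub_zero,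
        map_mul, sub_right_comm, ← mul_sub, sub_eq_add_neg]
      -- Staying through `-X i (!ε)`, the next letter has sign `!ε`, so no trace condition is
      -- needed. On returning to `none`, the only dangerous case is reentering row `i` before a
      -- letter of sign `ε`, where `hRX` gives trace zero.
      refine add_mem (mul_mem_of_span ?_ ih3) (neg_mem (Submodule.subset_span
        ⟨_, i', i, !ε, _, Ne.symm hne, hi, Or.inr (by simp), rfl⟩))
      rintro _ ⟨m, k, j, δ, x, hkj, hx, hm, rfl⟩
      rw [← mul_assoc, ← map_mul]
      refine Submodule.subset_span ⟨_, k, j, !δ, x, hkj, hx, ?_, rfl⟩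
      by_cases hj : j = i ∧ (!δ) = ε
      · obtain ⟨rfl, rfl⟩ := hj
        left
        refine hRX hii' ?_
        simpa using hm
      · exact Or.inr hj
    · rw [altProd_cons D, altProd_cons Z, dilation_mul_none, dilation_mul_none, hZ, mul_zero, add_zero,
        map_mul, add_sub_right_comm, ← mul_sub]
      refine add_mem (mul_mem_of_span ?_ ih3) (Submodule.subset_span
        ⟨_, i', i, ε, _, Ne.symm hne, hi, .exit i ε, rfl⟩)
      rintro _ ⟨m, k, j, δ, x, hkj, hx, hm, rfl⟩
      rw [← mul_assoc, ← map_mul]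
      exact Submodule.subset_span ⟨_, k, j, δ, x, hkj, hx, .step hii' hm, rfl⟩

/-- The diagonal entries of alternating products of dilation matrices of even length have trace
zero. -/
theorem trace_altProd_dilation (hρ : ∀ i j, ρ i j → i ≠ j) (htr : ∀ x y, τ (x * y) = τ (y * x))
    (hR : ∀ i ε, R i ε * R i ε = 1 - X i (!ε) * X i ε)
    (hX : ∀ ε (l : List ι), l ≠ [] → l.IsChain ρ → Even l.length → τ (altProd X ε l) = 0)
    (hW : ∀ {i j ε}, i ≠ j → ∀ a, u i j ε * φ a ∈ W i j ε)
    (hW' : ∀ {i j ε i' j' ε' m x}, i ≠ j → i' ≠ j' → x ∈ W i' j' ε' →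
      (τ m = 0 ∨ ¬ (i' = i ∧ j' = j ∧ ε' = !ε)) → u i j ε * (φ m * x) ∈ W i j ε)
    {τN : N →ₗ[ℂ] ℂ} (hτN : ∀ a, τN (φ a) = τ a)
    (hWτ : ∀ {i j ε x}, x ∈ W i j ε → ∀ m, τN (φ m * x) = 0)
    (ε : Bool) (l : List ι) (hne : l ≠ []) (hl : l.IsChain ρ) (heven : Even l.length)
    (a : Option ι) :
    τN (altProd (dilation (fun i ε => φ (X i ε)) (fun i ε => φ (R i ε)) u) ε l a a) = 0 := by
  obtain ⟨i, l, rfl⟩ := List.exists_cons_of_ne_nil hne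
  have hRX : ∀ {i i' ε m}, ρ i i' → ExitWord ρ X R i' (!ε) i (!ε) m → τ (R i ε * m) = 0 :=
    trace_defect_mul_exitWord hρ htr hR hX
  obtain ⟨h1, h2, h3⟩ := altProd_dilation_entries hρ hRX hW hW' ε i l hl a
  have hzero : ∀ {s : Set N}, (∀ y ∈ s, τN y = 0) → ∀ {x}, x ∈ Submodule.span ℂ s → τN x = 0 :=
    fun hs _ hx => (Submodule.span_le (p := LinearMap.ker τN)).2 hs hx
  rcases a with _ | a
  · have h := hzero (by rintro _ ⟨m, k, j, δ, x, -, hx, -, rfl⟩; exact hWτ hx m) h3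
    rwa [map_sub, hτN, altProd_dilation_none_none hρ _ _ hl, hX _ _ hne hl heven, sub_zero] at h
  · by_cases ha : a = i
    · subst ha
      have h := hzero (by rintro _ ⟨m, k, j, δ, x, -, hx, -, rfl⟩; exact hWτ hx m) h2
      rw [map_sub, hτN, sub_eq_zero] at h
      rw [h, altProd, dilation_mul_some_self]
      cases l with
      | nil => simp at heven
      | cons i' l =>
        have hii' := (List.isChain_cons_cons.1 hl).1
        rw [altProd_dilation_some_ne _ _ (hρ _ _ hii'), mul_zero, sub_zero]
        rcases altProd_dilation_none_some (X := X) (R := R) hρ (!ε) i' l hl.tail a with h | h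
        · rw [h, mul_zero, map_zero]
        -- Even length makes the closing defect operator equal to the opening one, `R a ε`, as `hRX`
        -- requires.
        · have hs : lastSign (!ε) (i' :: l) = !ε := (lastSign_eq_not_iff ε (a :: i' :: l)).2 heven
          rw [hs] at h
          exact hRX hii' h
    · simpa using hWτ (h1 a ha) 1

end Entries

/-! ### Unitary dilations of L-free sets -/

section LFreeDilation

lemma altProd_ofFn {ι A : Type*} [Monoid A] (f : ι → Bool → A) (ε : Bool) (k : ℕ)
    (y : Fin (2 * k) → ι) : altProd f ε (List.ofFn y) =
      (List.ofFn fun j : Fin k => f (y ⟨2 * j, by lia⟩) ε * f (y ⟨2 * j + 1, by lia⟩) (!ε)).prod := by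
  induction k with
  | zero => rfl
  | succ k ih =>
    have h := ih fun t : Fin (2 * k) => y ⟨t + 2, by lia⟩
    conv_rhs => rw [List.ofFn_succ, List.prod_cons]
    change altProd f ε (List.ofFn (n := 2 * k + 1 + 1) y) = _
    rw [List.ofFn_succ, List.ofFn_succ, altProd_cons, altProd_cons, Bool.not_not, ← mul_assoc]
    exact congrArg _ h

variable {A : Type*} [Ring A] [StarRing A] [Algebra ℂ A]

/-- The element `x i` or its adjoint, depending on a sign. -/
def signed {ι A : Type*} [Star A] (x : ι → A) (i : ι) (ε : Bool) : A :=
  if ε then x i else star (x i)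

omit [Algebra ℂ A] in
lemma star_signed {ι : Type*} (x : ι → A) (i : ι) (ε : Bool) :
    star (signed x i ε) = signed x i (!ε) := by
  cases ε <;> simp [signed]

omit [Algebra ℂ A] in
lemma IsLFree.apply_altProd {ι : Type*} {τ : A → ℂ} {x : ι → A}
    (hx : IsLFree τ (Set.range x)) (ε : Bool) (l : List ι) (hne : l ≠ [])
    (hl : l.IsChain fun i j => x i ≠ x j) (heven : Even l.length) :
    τ (altProd (signed x) ε l) = 0 := by
  obtain ⟨k, hk⟩ := heven
  have hk' : 2 * k = l.length := by lia
  have hpos : 1 ≤ k := by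
    have := List.length_pos_iff.2 hne
    lia
  let y : Fin (2 * k) → ι := fun t => l[(t : ℕ)]
  have hy : List.ofFn y = l := by
    refine List.ext_getElem (by simp [hk']) fun t h1 h2 => by simp [y]
  have := hx k hpos (fun t => x (y t)) (fun t => ⟨_, rfl⟩) fun t ht => by
    exact List.isChain_iff_getElem.1 hl t (by lia)
  rw [← hy, altProd_ofFn]
  cases ε
  · exact this.2
  · exact this.1

lemma card_offDiag_fin (n : ℕ) :
    Fintype.card {p : Fin n × Fin n // p.1 ≠ p.2} = n * (n - 1) := by
  rw [Fintype.card_subtype, Nat.mul_sub_one]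
  have := Finset.offDiag_card (Finset.univ : Finset (Fin n))
  rw [Finset.card_univ, Fintype.card_fin] at this
  rw [← this]
  congr 1
  ext p
  simp

variable {N : Type*} [Ring N] [StarRing N] [Algebra ℂ N] [StarModule ℂ N]

/-- An L-free family of contractions dilates to an L-free family of unitary matrices over a free
product with a free group. -/
theorem exists_lFree_unitary_dilation {n : ℕ} {τ : A →ₗ[ℂ] ℂ} {τN : N →ₗ[ℂ] ℂ} (φ : A →⋆ₐ[ℂ] N)
    (v : FreeGroup (Fin (n * (n - 1))) →* N) {B : Fin 2 → StarSubalgebra ℂ N}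
    (hτ : τ 1 = 1) (htr : ∀ x y, τ (x * y) = τ (y * x)) (htrN : ∀ x y, τN (x * y) = τN (y * x))
    (hfree : AreFree τN B) (hφ : ∀ a, φ a ∈ B 0) (hv : ∀ g, v g ∈ B 1)
    (hτφ : ∀ a, τN (φ a) = τ a) (hτv : ∀ g ≠ 1, τN (v g) = 0) (hvstar : ∀ g, star (v g) = v g⁻¹)
    {x : Fin n → A} (hx : IsLFree τ (Set.range x))
    (hdef : ∀ i, ∃ s t : A, star s = s ∧ star t = t ∧ s * s = 1 - star (x i) * x i ∧
      t * t = 1 - x i * star (x i) ∧ x i * s = t * x i) :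
    ∃ U : Fin n → Matrix (Fin (n + 1)) (Fin (n + 1)) N,
      (∀ i, U i ∈ unitary (Matrix (Fin (n + 1)) (Fin (n + 1)) N)) ∧
      IsLFree (matrixTrace τN) (Set.range U) ∧
      ∀ i, Matrix.single 0 0 1 * U i * Matrix.single 0 0 1 = Matrix.single 0 0 (φ (x i)) := by
  classical
  choose s t hs ht hss htt hst using hdef
  let R : Fin n → Bool → A := fun i ε => if ε then s i else t i
  have hR : ∀ i ε, R i ε * R i ε = 1 - signed x i (!ε) * signed x i ε := by
    rintro i (_ | _)
    · simpa [R, signed] using htt i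
    · simpa [R, signed] using hss i
  have hRstar : ∀ i ε, star (R i ε) = R i ε := by
    rintro i (_ | _)
    · simpa [R] using ht i
    · simpa [R] using hs i
  have hXR : ∀ i ε, signed x i ε * R i ε = R i (!ε) * signed x i ε := by
    rintro i (_ | _)
    · simpa [R, signed, hs, ht] using (congrArg star (hst i)).symm
    · simpa [R, signed] using hst i
  -- One free generator for each ordered pair of distinct indices. The values of `u` and `W` at i =
  -- j are placeholders, since `dilation` never uses `u i i`.
  let e := Fintype.equivFinOfCardEq (card_offDiag_fin n)
  let u : Fin n → Fin n → Bool → N := fun i j ε =>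
    if h : i ≠ j then v (freeLetter (e ⟨(i, j), h⟩) ε) else 1
  let W : Fin n → Fin n → Bool → Submodule ℂ N := fun i j ε =>
    if h : i ≠ j then reducedSpan τ φ.toAlgHom v (e ⟨(i, j), h⟩) ε else ⊥
  have hu : ∀ i j ε, i ≠ j → star (u i j ε) = u i j (!ε) := by
    intro i j ε h
    simp only [u, dif_pos h, hvstar, freeLetter_inv]
  have hu' : ∀ i j ε, i ≠ j → u i j ε * u i j (!ε) = 1 := by
    intro i j ε h
    simp only [u, dif_pos h, ← map_mul, ← freeLetter_inv, mul_inv_cancel, map_one]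
  let D := dilation (fun i ε => φ (signed x i ε)) (fun i ε => φ (R i ε)) u
  have hDstar : ∀ i ε, star (D i ε) = D i (!ε) :=
    star_dilation (fun i ε => by rw [← map_star, star_signed])
      (fun i ε => by rw [← map_star, hRstar]) hu
  have hD : ∀ i ε, D i ε * D i (!ε) = 1 := fun i ε =>
    dilation_mul_dilation i ε (fun i ε => by rw [← map_mul, hR, map_sub, map_mul, map_one])
      (fun i ε => by rw [← map_mul, hXR, map_mul]) hu'
  have htrace : ∀ ε (l : List (Fin n)), l ≠ [] → l.IsChain (fun i j => x i ≠ x j) →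
      Even l.length → ∀ a, τN (altProd D ε l a a) = 0 := by
    refine trace_altProd_dilation (φ := φ.toAlgHom) (W := W) (fun i j h hij => h (hij ▸ rfl)) htr
      hR hx.apply_altProd ?_ ?_ hτφ ?_
    · intro i j ε h a
      simp only [u, W, dif_pos h]
      exact freeLetter_mul_mem_reducedSpan _ ε a
    · intro i j ε i' j' ε' m y h h' hy hm
      simp only [W, dif_pos h'] at hy
      simp only [u, W, dif_pos h]
      refine freeLetter_mul_mul_mem_reducedSpan hτ hy (hm.imp_right ?_)
      rintro hne ⟨heq, hε⟩
      have := congrArg Subtype.val (e.injective heq)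
      simp only [Prod.mk.injEq] at this
      exact hne ⟨this.1, this.2, hε⟩
    · intro i j ε y hy m
      by_cases h : i ≠ j
      · simp only [W, dif_pos h] at hy
        exact trace_mul_reducedSpan hτ htrN hfree hφ hv hτφ hτv hy m
      · simp only [W, dif_neg h, Submodule.mem_bot] at hy
        simp [hy]
  -- a system of representatives, so that equal elements have equal dilations
  let r : Fin n → Fin n := fun i => Set.rangeSplitting x ⟨x i, i, rfl⟩
  have hxr : ∀ i, x (r i) = x i := fun i => Set.apply_rangeSplitting x _
  have hr : ∀ i j, x i = x j → r i = r j := fun i j h => by simp only [r, h]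
  -- The index `none` becomes 0, so the corner cut out by e₀₀ is the (`none`, `none`) entry.
  let F := Matrix.reindexAlgEquiv ℂ N (finSuccEquiv n).symm
  have hFstar : ∀ Z, star (F Z) = F (star Z) := fun Z => rfl
  have hU : ∀ i ε, signed (fun i => F (D (r i) true)) i ε = F (D (r i) ε) := by
    rintro i (_ | _)
    · simp [signed, hFstar, hDstar]
    · simp [signed]
  refine ⟨fun i => F (D (r i) true), fun i => ?_, fun k hk y hy hne => ?_, fun i => ?_⟩
  · rw [Unitary.mem_iff, hFstar, hDstar, ← map_mul, ← map_mul, hD]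
    have := hD (r i) false
    rw [Bool.not_false] at this
    rw [Bool.not_true, this, map_one]
    exact ⟨rfl, rfl⟩
  · choose idx hidx using hy
    obtain rfl : (fun t => F (D (r (idx t)) true)) = y := funext hidx
    let l := List.ofFn fun t => r (idx t)
    have hlen : l.length = 2 * k := by simp [l]
    have hl : l.IsChain fun i j => x i ≠ x j := by
      refine List.isChain_iff_getElem.2 fun t ht => ?_
      simp only [l, List.getElem_ofFn, hxr]
      -- Distinctness is known only for the matrices; equal `x` values would have the same
      -- representative and so the same matrix.
      exact fun h => hne t (by lia) (by simp only [hr _ _ h])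
    have hprod : ∀ ε, (List.ofFn fun j : Fin k => F (D (r (idx ⟨2 * j, by lia⟩)) ε) *
        F (D (r (idx ⟨2 * j + 1, by lia⟩)) (!ε))).prod = F (altProd D ε l) := by
      intro ε
      rw [altProd_ofFn, map_list_prod, List.map_ofFn]
      congr! 3
      simp
    have hzero : ∀ ε, matrixTrace τN (F (altProd D ε l)) = 0 := by
      intro ε
      rw [matrixTrace, Finset.sum_eq_zero, mul_zero]
      intro a _
      exact htrace ε l (List.ne_nil_of_length_pos (by lia)) hl ⟨k, by lia⟩ _
    refine ⟨?_, ?_⟩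
    · simp only [hFstar, hDstar]
      exact (congrArg _ (hprod true)).trans (hzero true)
    · simp only [hFstar, hDstar]
      exact (congrArg _ (hprod false)).trans (hzero false)
  · rw [Matrix.single_mul_mul_single, one_mul, mul_one]
    change Matrix.single 0 0 (φ (x (r i))) = _
    rw [hxr]

end LFreeDilation

theorem proposition3p4 {H : Type u} [NormedAddCommGroup H] [InnerProductSpace ℂ H]
    [CompleteSpace H] (M : VonNeumannAlgebra H) (τ : M.toStarSubalgebra →ₗ[ℂ] ℂ)
    (hτ : IsFaithfulNormalTracialState M τ)
    (n : ℕ) (x : Fin n → M.toStarSubalgebra)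
    (hx : IsLFree τ (Set.range x)) (hx_norm : ∀ i, ‖x i‖ ≤ 1) :
    ∃ (K : Type u) (_ : NormedAddCommGroup K) (_ : InnerProductSpace ℂ K) (_ : CompleteSpace K)
      (N : VonNeumannAlgebra K) (τN : N.toStarSubalgebra →ₗ[ℂ] ℂ)
      (φ : M.toStarSubalgebra →⋆ₐ[ℂ] N.toStarSubalgebra)
      (ψ : (groupVonNeumann (FreeGroup (Fin (n * (n - 1))))).toStarSubalgebra →⋆ₐ[ℂ]
        N.toStarSubalgebra),
      IsTracialFreeProduct M τ (groupVonNeumann (FreeGroup (Fin (n * (n - 1)))))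
        (groupTrace (FreeGroup (Fin (n * (n - 1))))) N τN φ ψ ∧
      ∃ U : Fin n → Matrix (Fin (n + 1)) (Fin (n + 1)) N.toStarSubalgebra,
        (∀ i, U i ∈ unitary (Matrix (Fin (n + 1)) (Fin (n + 1)) N.toStarSubalgebra)) ∧
        IsLFree (matrixTrace τN) (Set.range U) ∧
        ∀ i, Matrix.single 0 0 1 * U i * Matrix.single 0 0 1 = Matrix.single 0 0 (φ (x i)) := by
  have hΓ := isFaithfulNormalTracialState_groupTrace (Γ := FreeGroup (Fin (n * (n - 1))))
  obtain ⟨K, i₁, i₂, i₃, N, τN, φ, ψ, hN⟩ := exists_tracialFreeProduct.{u, 0, u} M τ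
    (groupVonNeumann (FreeGroup (Fin (n * (n - 1))))) (groupTrace (FreeGroup (Fin (n * (n - 1)))))
    hτ.tracial hΓ.tracial hτ.hasCyclicRep.{u, u} hΓ.hasCyclicRep.{u, 0}
  refine ⟨K, i₁, i₂, i₃, N, τN, φ, ψ, hN, ?_⟩
  have hdef : ∀ i, ∃ s t : M.toStarSubalgebra, star s = s ∧ star t = t ∧
      s * s = 1 - star (x i) * x i ∧ t * t = 1 - x i * star (x i) ∧ x i * s = t * x i :=
    have := M.isClosed
    fun i => exists_defect (A := M.toStarSubalgebra) (x i) (hx_norm i)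
  let v : FreeGroup (Fin (n * (n - 1))) →* N.toStarSubalgebra :=
    (MonoidHomClass.toMonoidHom ψ).comp (groupUnitary (FreeGroup (Fin (n * (n - 1)))))
  have hv0 : ∀ g ≠ 1, τN (v g) = 0 := fun g hg =>
    (hN.trace_right (groupUnitary _ g)).trans (groupTrace_groupUnitary hg)
  have hvstar : ∀ g, star (v g) = v g⁻¹ := fun g =>
    (map_star ψ (groupUnitary _ g)).symm.trans (congrArg ψ (star_groupUnitary g))
  have hφB : ∀ a, φ a ∈ (![φ.range, ψ.range] : Fin 2 → StarSubalgebra ℂ N.toStarSubalgebra) 0 :=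
    fun a => ⟨a, rfl⟩
  have hvB : ∀ g, v g ∈ (![φ.range, ψ.range] : Fin 2 → StarSubalgebra ℂ N.toStarSubalgebra) 1 :=
    fun g => ⟨groupUnitary _ g, rfl⟩
  exact exists_lFree_unitary_dilation φ v hτ.map_one hτ.tracial hN.isTracial.tracial hN.free hφB
    hvB hN.trace_left hv0 hvstar hx hdef
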